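/- Work in classical first-order logic with equality in the language $\{\in\}$ of set theory, and let $\vdash$ denote provability. A formula is $\Delta_0$ if all its quantifiers are bounded ($\forall x\in y$, $\exists x\in y$); a sentence is $\Pi_2$ if it has the form $\forall x_1\cdots\forall x_k\,\exists y_1\cdots\exists y_m\,\psi$ with $k,m\ge 0$ and $\psi$ a $\Delta_0$ formula. Let BST (Basic Set Theory) be the theory with the following axioms: Emptyset, Extensionality, Pairing, Union, Cartesian Product ($\forall x\forall y\exists z\,(z=x\times y)$), Infinity ($\exists x\,[\emptyset\in x\wedge\forall y\in x\,\exists z\in x\,(z=y\cup\{y\})]$), and $\Delta_0$-Separation ($\forall \bar z\,\forall a\,\exists b\,\forall y\,(y\in b\leftrightarrow y\in a\wedge\varphi(y,\bar z))$ for every $\Delta_0$ formula $\varphi$ in which $b$ is not free). Represent formulas inside set theory by sets: $(0,i,j)$ for $v_i=v_j$, $(1,i,j)$ for $v_i\in v_j$, $(2,\varphi,\psi)$ for $\varphi\to\psi$, $(3,i,\varphi)$ for $\forall v_i\,\varphi$, and $(4,0,0)$ for falsity, where $i,j$ are natural numbers. Let $(y,\in)\models\varphi$ be the formula of set theory expressing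 that, for some natural number $k$ bounding the indices of the variables of $\varphi$, there is a relation between (codes of) formulas and assignments $k\to y$ that obeys Tarski's clauses for a construction of $\varphi$ and under which $\varphi$ is satisfied by all assignments. Let $(y,\in)\models\mathrm{ZFC}$ be the formula $\forall\varphi\,(\varphi\in\mathrm{ZFC}\to (y,\in)\models\varphi)$, where $\varphi\in\mathrm{ZFC}$ is the formula expressing that $\varphi$ is the code of an axiom of ZFC. Let $\mathrm{Tr}(y)$ say that $y$ is transitive. Put $$Loc(\mathrm{ZFC}):\quad \forall x\,\exists y\,\bigl(x\in y\wedge \mathrm{Tr}(y)\wedge (y,\in)\models \mathrm{ZFC}\bigr),\qquad \mathrm{LZFC}=\mathrm{BST}+Loc(\mathrm{ZFC}).$$ Lemma. (i) For every $n\ge 0$, $\ \mathrm{LZFC}\vdash \forall x_1\cdots\forall x_n\,\exists y\,\bigl(x_1\in y\wedge\cdots\wedge x_n\in y\wedge \mathrm{Tr}(y)\wedge (y,\in)\models\mathrm{ZFC}\bigr)$. (ii) For every $\Pi_2$ sentence $\varphi$, if $\mathrm{ZFC}\vdash\varphi$ then $\mathrm{LZFC}\vdash\varphi$. -/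

import Mathlib

/-! # First-order derivability, the theories ZFC, BST and LZFC -/

section Derivability

open FirstOrder FirstOrder.Language

universe u v

/-- `φ(t)`: the term `t` is substituted for the single bound variable left open in `φ`.
The free variables are named by natural numbers, so no variable of `t` can be captured. -/
def FirstOrder.Language.BoundedFormula.instantiate {L : FirstOrder.Language.{u, v}}
    (φ : L.BoundedFormula ℕ 1) (t : L.Term ℕ) : L.Formula ℕ :=
  φ.toFormula.subst (Sum.elim Term.var fun _ => t)

/-- A sentence, seen as a formula with free variables among `v₀, v₁, …` (none of which it has). -/
def FirstOrder.Language.Sentence.toFormulaNat {L : FirstOrder.Language.{u, v}} (σ : L.Sentence) :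
    L.Formula ℕ :=
  BoundedFormula.subst σ fun e : Empty => e.elim

/-- Derivability of formulas from a set `T` of sentences in a Hilbert calculus for classical
first-order logic with equality. -/
inductive FirstOrder.Language.Theory.Derivable {L : FirstOrder.Language.{u, v}} (T : L.Theory) :
    L.Formula ℕ → Prop
  | hyp {σ : L.Sentence} (h : σ ∈ T) : Derivable T σ.toFormulaNat
  | imp_weaken (φ ψ : L.Formula ℕ) : Derivable T (φ.imp (ψ.imp φ))
  | imp_distrib (φ ψ χ : L.Formula ℕ) :
      Derivable T ((φ.imp (ψ.imp χ)).imp ((φ.imp ψ).imp (φ.imp χ)))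
  | double_neg (φ : L.Formula ℕ) : Derivable T (φ.not.not.imp φ)
  | all_elim (φ : L.BoundedFormula ℕ 1) (t : L.Term ℕ) :
      Derivable T (φ.all.imp (φ.instantiate t))
  | eq_refl (t : L.Term ℕ) : Derivable T (t.equal t)
  | eq_subst (φ : L.BoundedFormula ℕ 1) (s t : L.Term ℕ) :
      Derivable T ((s.equal t).imp ((φ.instantiate s).imp (φ.instantiate t)))
  | modus_ponens {φ ψ : L.Formula ℕ} (h₁ : Derivable T (φ.imp ψ)) (h₂ : Derivable T φ) :
      Derivable T ψ
  | all_intro {φ : L.Formula ℕ} {ψ : L.BoundedFormula ℕ 1} (x : ℕ)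
      (hφ : x ∉ φ.freeVarFinset) (hψ : x ∉ ψ.freeVarFinset)
      (h : Derivable T (φ.imp (ψ.instantiate (Term.var x)))) : Derivable T (φ.imp ψ.all)

/-- `T ⊢ σ`: the sentence `σ` is provable from `T`. -/
def FirstOrder.Language.Theory.Proves {L : FirstOrder.Language.{u, v}} (T : L.Theory) (σ : L.Sentence) :
    Prop :=
  T.Derivable σ.toFormulaNat

end Derivability

namespace SetTh

open FirstOrder FirstOrder.Language

/-! ## The language of set theory -/

/-- The only non-logical symbol is the binary relation symbol `∈`. -/
inductive MemRel : ℕ → Type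
  | mem : MemRel 2

/-- The language `{∈}` of set theory. -/
def LSet : FirstOrder.Language.{0, 0} := ⟨fun _ => Empty, MemRel⟩

/-- Formulas of set theory whose free variables are `0, …, n - 1` (the quantifier in
`all : Fml (n + 1) → Fml n` binds the variable with the number `n`). -/
abbrev Fml (n : ℕ) : Type := LSet.BoundedFormula Empty n

section Building

variable {n : ℕ}

def fmem (i j : Fin n) : Fml n :=
  Relations.boundedFormula₂ (L := LSet) (MemRel.mem : LSet.Relations 2)
    (Term.var (Sum.inr i)) (Term.var (Sum.inr j))

def feq (i j : Fin n) : Fml n :=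
  Term.bdEqual (L := LSet) (Term.var (Sum.inr i)) (Term.var (Sum.inr j))

abbrev fand (φ ψ : Fml n) : Fml n := φ ⊓ ψ

abbrev f_or (φ ψ : Fml n) : Fml n := φ ⊔ ψ

local infixr:69 " ⋏ " => fand

local infixr:68 " ⋎ " => f_or

/-- `∀ x, f x`, where `f` is given the freshly bound variable. -/
def fall (f : Fin (n + 1) → Fml (n + 1)) : Fml n := ∀' (f (Fin.last n))

/-- `∃ x, f x`. -/
def fex (f : Fin (n + 1) → Fml (n + 1)) : Fml n := ∃' (f (Fin.last n))

/-- `∀ x ∈ i, f x`. -/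
def ball (i : Fin n) (f : Fin (n + 1) → Fml (n + 1)) : Fml n :=
  fall fun x => fmem x i.castSucc ⟹ f x

/-- `∃ x ∈ i, f x`. -/
def bex (i : Fin n) (f : Fin (n + 1) → Fml (n + 1)) : Fml n :=
  fex fun x => fmem x i.castSucc ⋏ f x

/-! ## The Lévy hierarchy -/

/-- Bounded formulas. -/
inductive IsDelta0 : ∀ {n : ℕ}, Fml n → Prop
  | falsum {n : ℕ} : IsDelta0 (BoundedFormula.falsum : Fml n)
  | equal {n : ℕ} (i j : Fin n) : IsDelta0 (feq i j)
  | mem {n : ℕ} (i j : Fin n) : IsDelta0 (fmem i j)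
  | imp {n : ℕ} {φ ψ : Fml n} (h₁ : IsDelta0 φ) (h₂ : IsDelta0 ψ) : IsDelta0 (φ ⟹ ψ)
  | ball {n : ℕ} (i : Fin n) {φ : Fml (n + 1)} (h : IsDelta0 φ) : IsDelta0 (ball i fun _ => φ)
  | bex {n : ℕ} (i : Fin n) {φ : Fml (n + 1)} (h : IsDelta0 φ) : IsDelta0 (bex i fun _ => φ)

/-- `∃ y₁ … ∃ yₘ ψ` with `ψ` bounded. -/
inductive IsSigma1 : ∀ {n : ℕ}, Fml n → Prop
  | delta0 {n : ℕ} {φ : Fml n} (h : IsDelta0 φ) : IsSigma1 φ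
  | ex {n : ℕ} {φ : Fml (n + 1)} (h : IsSigma1 φ) : IsSigma1 (∃' φ)

/-- `∀ x₁ … ∀ xₖ ∃ y₁ … ∃ yₘ ψ` with `ψ` bounded. -/
inductive IsPi2 : ∀ {n : ℕ}, Fml n → Prop
  | sigma1 {n : ℕ} {φ : Fml n} (h : IsSigma1 φ) : IsPi2 φ
  | all {n : ℕ} {φ : Fml (n + 1)} (h : IsPi2 φ) : IsPi2 (∀' φ)

/-! ## Elementary set-theoretic notions as formulas -/

/-- A variable remains a variable under a further quantifier, with the same number. In the
formulas below this coercion is inserted wherever it is needed. -/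
local instance coeVar : Coe (Fin n) (Fin (n + 1)) := ⟨Fin.castSucc⟩

/-- `x = ∅`. -/
def isEmpty (x : Fin n) : Fml n := fall fun z => ∼ (fmem z x)

/-- `x ⊆ y`. -/
def subset (x y : Fin n) : Fml n := ball x fun z => fmem z y

/-- `Tr(x)`: `x` is transitive. -/
def isTransitive (x : Fin n) : Fml n := ball x fun z => subset z x

/-- `p = {x, y}`. -/
def isUPair (p x y : Fin n) : Fml n :=
  fmem x p ⋏ fmem y p ⋏ ball p fun z => feq z x ⋎ feq z y

/-- `p = (x, y) = {{x}, {x, y}}`. -/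
def isOPair (p x y : Fin n) : Fml n :=
  bex p fun s => bex p fun t => isUPair s x x ⋏ isUPair t x y ⋏ isUPair p s t

/-- `t = (x, (y, z))`. -/
def isTriple (t x y z : Fin n) : Fml n :=
  bex t fun w => bex w fun q => isOPair q y z ⋏ isOPair t x q

/-- `u = ⋃ x`. -/
def isUnion (u x : Fin n) : Fml n :=
  (ball x fun y => subset y u) ⋏ ball u fun z => bex x fun y => fmem z y

/-- `z = x × y`. -/
def isProd (z x y : Fin n) : Fml n :=
  (ball z fun p => bex x fun a => bex y fun b => isOPair p a b) ⋏
    ball x fun a => ball y fun b => bex z fun p => isOPair p a b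

/-- `s = x ∪ {x}`. -/
def isSucc (s x : Fin n) : Fml n :=
  fmem x s ⋏ subset x s ⋏ ball s fun z => fmem z x ⋎ feq z x

/-- `∅ ∈ w` and `y ∪ {y} ∈ w` for all `y ∈ w`. -/
def isInductive (w : Fin n) : Fml n :=
  (bex w fun e => isEmpty e) ⋏ ball w fun y => bex w fun z => isSucc z y

/-- `x` is an ordinal: a transitive set strictly linearly ordered by `∈`. -/
def isOrdinal (x : Fin n) : Fml n :=
  isTransitive x ⋏ (ball x fun y => isTransitive y) ⋏ (ball x fun y => ∼ (fmem y y)) ⋏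
    ball x fun y => ball x fun z => fmem y z ⋎ feq y z ⋎ fmem z y

/-- `x` is a natural number: an ordinal such that `x` and all elements of `x` are `∅` or
successors. -/
def isNat (x : Fin n) : Fml n :=
  isOrdinal x ⋏ (isEmpty x ⋎ bex x fun y => isSucc x y) ⋏
    ball x fun z => isEmpty z ⋎ bex z fun y => isSucc z y

/-- `x` is the natural number `k`. -/
def isNum : ℕ → ∀ {n : ℕ}, Fin n → Fml n
  | 0, _, x => isEmpty x
  | k + 1, _, x => fex fun y => isNum k y ⋏ isSucc x y

/-- `(i, a) ∈ s`, that is, `s(i) = a` when `s` is a function. -/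
def app (s i a : Fin n) : Fml n := bex s fun p => isOPair p i a

/-- `s` is a function from `x` to `y`. -/
def isFunction (s x y : Fin n) : Fml n :=
  (ball s fun p => bex x fun i => bex y fun a => isOPair p i a) ⋏
    ball x fun i => bex y fun a => app s i a ⋏ ball y fun b => app s i b ⟹ feq b a

/-! ## The theories ZFC and BST -/

/-- The formula `ψ(z₀, …, z_{m-1})` in which the variable `i` is replaced by `z i`. -/
def rename {m : ℕ} (ψ : Fml m) (z : Fin m → Fin n) : Fml n :=
  BoundedFormula.relabel (n := n) (k := 0)
    (Sum.elim (fun e : Empty => e.elim) fun i => (Sum.inr (z i) : Empty ⊕ Fin n)) ψ.toFormula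

def extensionality : LSet.Sentence :=
  fall (n := 0) fun x => fall fun y => (fall fun z => fmem z x ⇔ fmem z y) ⟹ feq x y

def foundation : LSet.Sentence :=
  fall (n := 0) fun x => (fex fun y => fmem y x) ⟹ bex x fun y => ball y fun z => ∼ (fmem z x)

def emptyset : LSet.Sentence := fex (n := 0) fun x => isEmpty x

def pairing : LSet.Sentence :=
  fall (n := 0) fun x => fall fun y => fex fun z => isUPair z x y

def union : LSet.Sentence := fall (n := 0) fun x => fex fun y => isUnion y x

def cartesianProduct : LSet.Sentence :=
  fall (n := 0) fun x => fall fun y => fex fun z => isProd z x y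

def powerset : LSet.Sentence :=
  fall (n := 0) fun x => fex fun p => fall fun z => fmem z p ⇔ subset z x

def infinity : LSet.Sentence := fex (n := 0) fun w => isInductive w

/-- Every set of nonempty, pairwise disjoint sets has a set of representatives. -/
def choice : LSet.Sentence :=
  fall (n := 0) fun x =>
    ((ball x fun y => fex fun z => fmem z y) ⋏
      (ball x fun y => ball x fun y' =>
        (fex fun z => fmem z y ⋏ fmem z y') ⟹ feq y y')) ⟹
    fex fun c => ball x fun y => fex fun z => fall fun t => (fmem t y ⋏ fmem t c) ⇔ feq t z

/-- `∀ z₀ … z_{n-1} ∀ a ∃ b ∀ y (y ∈ b ↔ y ∈ a ∧ ψ(z₀, …, z_{n-1}, y))`. -/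
def separation (n : ℕ) (ψ : Fml (n + 1)) : LSet.Sentence :=
  BoundedFormula.alls (n := n) <|
    fall fun a => fex fun b => fall fun y =>
      fmem y b ⇔
        (fmem y a ⋏
          rename ψ (Fin.lastCases (motive := fun _ => Fin (n + 3)) y fun i : Fin n => i))

/-- `∀ z₀ … z_{n-1} ∀ a (∀ x ∈ a ∃! y ψ(z₀, …, z_{n-1}, x, y) →
∃ b ∀ x ∈ a ∃ y ∈ b ψ(z₀, …, z_{n-1}, x, y))`. -/
def replacement (n : ℕ) (ψ : Fml (n + 2)) : LSet.Sentence :=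
  BoundedFormula.alls (n := n) <|
    fall fun a =>
      (ball a fun x => fex fun u => fall fun y =>
        rename ψ (Fin.lastCases (motive := fun _ => Fin (n + 4)) y
          (Fin.lastCases (motive := fun _ => Fin (n + 4)) x fun i : Fin n => i)) ⇔ feq y u) ⟹
      fex fun b => ball a fun x => bex b fun y =>
        rename ψ (Fin.lastCases (motive := fun _ => Fin (n + 4)) y
          (Fin.lastCases (motive := fun _ => Fin (n + 4)) x fun i : Fin n => i))

/-- The axioms of ZFC other than the instances of the two schemes. -/
def singleAxioms : List LSet.Sentence :=
  [extensionality, foundation, pairing, union, powerset, infinity, choice]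

def ZFC : LSet.Theory :=
  {σ | σ ∈ singleAxioms ∨ (∃ n, ∃ ψ : Fml (n + 1), σ = separation n ψ) ∨
    ∃ n, ∃ ψ : Fml (n + 2), σ = replacement n ψ}

/-- Basic set theory. -/
def BST : LSet.Theory :=
  {σ | σ ∈ [emptyset, extensionality, pairing, union, cartesianProduct, infinity] ∨
    ∃ n, ∃ ψ : Fml (n + 1), IsDelta0 ψ ∧ σ = separation n ψ}

/-! ## Formulas as sets

Inside set theory the formulas with the variables `v₀, v₁, …` are represented by sets:
`v_i = v_j` by `(0, i, j)`, `v_i ∈ v_j` by `(1, i, j)`, `φ → ψ` by `(2, φ, ψ)`, `∀ v_i φ` by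
`(3, i, φ)`, and falsity by `(4, 0, 0)`. -/

/-- `c = (k, x, y)`. -/
def isNode (k : ℕ) (c x y : Fin n) : Fml n := fex fun t => isNum k t ⋏ isTriple c t x y

/-- `(q, c) ∈ w` for some `q ∈ r`. -/
def occursBefore (w r c : Fin n) : Fml n := bex r fun q => app w q c

/-- `(r, c) ∈ w` for some `r`. -/
def occurs (w c : Fin n) : Fml n := fex fun r => app w r c

/-- `w` is a construction of formulas with variables `v_i`, `i ∈ d`: a set of pairs `(r, c)` with
`r` a natural number, in which each `c` is atomic or formed from codes with a smaller `r`. -/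
def isConstruction (d w : Fin n) : Fml n :=
  ball w fun p => fex fun r => fex fun c => isOPair p r c ⋏ isNat r ⋏
    ((bex d fun i => bex d fun j => isNode 0 c i j ⋎ isNode 1 c i j) ⋎
      (fex fun x => fex fun y => isNode 2 c x y ⋏ occursBefore w r x ⋏ occursBefore w r y) ⋎
      (bex d fun i => fex fun x => isNode 3 c i x ⋏ occursBefore w r x) ⋎
      fex fun z => isEmpty z ⋏ isNode 4 c z z)

/-- `c` is a formula whose variables, free or bound, are among the `v_i`, `i ∈ d`. -/
def isFormulaOver (d c : Fin n) : Fml n := fex fun w => isConstruction d w ⋏ occurs w c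

/-- A formula scheme with the named variables `v₀, v₁, …` and one metavariable (`hole`), for which
a formula can be put. -/
inductive Scheme : Type
  | hole : Scheme
  | eq (i j : ℕ) : Scheme
  | mem (i j : ℕ) : Scheme
  | imp (s t : Scheme) : Scheme
  | all (i : ℕ) (s : Scheme) : Scheme
  | falsum : Scheme

namespace Scheme

def not (s : Scheme) : Scheme := s.imp falsum

def and (s t : Scheme) : Scheme := (s.imp t.not).not

def iff (s t : Scheme) : Scheme := (s.imp t).and (t.imp s)

def ex (i : ℕ) (s : Scheme) : Scheme := (all i s.not).not

end Scheme

/-- `c` is the formula obtained from the scheme by putting the formula `h` for the metavariable. -/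
def isInstance : Scheme → ∀ {n : ℕ}, Fin n → Fin n → Fml n
  | .hole, _, h, c => feq c h
  | .eq i j, _, _, c => fex fun x => fex fun y => isNum i x ⋏ isNum j y ⋏ isNode 0 c x y
  | .mem i j, _, _, c => fex fun x => fex fun y => isNum i x ⋏ isNum j y ⋏ isNode 1 c x y
  | .imp s t, _, h, c =>
      fex fun x => fex fun y => isInstance s h x ⋏ isInstance t h y ⋏ isNode 2 c x y
  | .all i s, _, h, c => fex fun x => fex fun y => isNum i x ⋏ isInstance s h y ⋏ isNode 3 c x y
  | .falsum, _, _, c => fex fun z => isEmpty z ⋏ isNode 4 c z z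

/-- The number of the variable that a term of the language of set theory consists of. -/
def varNumber : LSet.Term (Empty ⊕ Fin n) → ℕ
  | .var (.inl e) => e.elim
  | .var (.inr i) => i
  | .func f _ => Empty.elim f

/-- A formula with the variables `0, …, n - 1` as a formula (a scheme without metavariable) with
named variables; the variable bound by a quantifier is `v_n`, where `n` variables are in scope. -/
def toScheme : ∀ {n : ℕ}, Fml n → Scheme
  | _, .falsum => .falsum
  | _, .equal t s => .eq (varNumber t) (varNumber s)
  | _, .rel MemRel.mem ts => .mem (varNumber (ts 0)) (varNumber (ts 1))
  | _, .imp φ ψ => .imp (toScheme φ) (toScheme ψ)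
  | n, .all φ => .all n (toScheme φ)

/-- `∀ v₂ ∃ v₃ ∀ v₁ (v₁ ∈ v₃ ↔ v₁ ∈ v₂ ∧ ψ)`. -/
def separationScheme : Scheme :=
  .all 2 (.ex 3 (.all 1 (.iff (.mem 1 3) (.and (.mem 1 2) .hole))))

/-- `∀ v₂ (∀ v₀ ∈ v₂ ∃! v₁ ψ → ∃ v₃ ∀ v₀ ∈ v₂ ∃ v₁ ∈ v₃ ψ)`, where `∃! v₁ ψ` is
`∃ v₄ ∀ v₁ (ψ ↔ v₁ = v₄)`. -/
def replacementScheme : Scheme :=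
  .all 2 (.imp (.all 0 (.imp (.mem 0 2) (.ex 4 (.all 1 (.iff .hole (.eq 1 4))))))
    (.ex 3 (.all 0 (.imp (.mem 0 2) (.ex 1 (.and (.mem 1 3) .hole))))))

/-- `c ∈ ZFC`: the set `c` is (the code of) an axiom of ZFC. The metavariable stands for any
formula in which the auxiliary variables `v₃` and, for replacement, `v₄` do not occur; its other
free variables are parameters, over which the truth of the axiom quantifies universally. -/
def isZFCAxiom (c : Fin n) : Fml n :=
  (singleAxioms.foldr (fun σ φ => isInstance (toScheme (n := 0) σ) c c ⋎ φ) ⊥) ⋎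
    (fex fun d => fex fun h => (ball d fun i => isNat i ⋏ ∼ (isNum 3 i)) ⋏
      isFormulaOver d h ⋏ isInstance separationScheme h c) ⋎
    fex fun d => fex fun h => (ball d fun i => isNat i ⋏ ∼ (isNum 3 i) ⋏ ∼ (isNum 4 i)) ⋏
      isFormulaOver d h ⋏ isInstance replacementScheme h c

/-! ## Satisfaction in a set -/

/-- `s(j) = s'(j)` for all `j ∈ k` other than `i`. -/
def agreeOff (y k i s s' : Fin n) : Fml n :=
  ball k fun j => ∼ (feq j i) ⟹ bex y fun a => app s j a ⋏ app s' j a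

/-- `t` obeys Tarski's clauses for the formulas occurring in `w` and the assignments in `m`, the
functions from the natural number `k` to `y`: `(c, s) ∈ t` if and only if `(y, ∈)` satisfies `c`
under `s`. -/
def isSatisfaction (y k w m t : Fin n) : Fml n :=
  fall fun c => occurs w c ⟹ ball m fun s =>
    (ball k fun i => ball k fun j => isNode 0 c i j ⟹
      (app t c s ⇔ bex y fun a => app s i a ⋏ app s j a)) ⋏
    (ball k fun i => ball k fun j => isNode 1 c i j ⟹
      (app t c s ⇔ bex y fun a => bex y fun b => app s i a ⋏ app s j b ⋏ fmem a b)) ⋏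
    (fall fun x => fall fun z => isNode 2 c x z ⟹
      (app t c s ⇔ (app t x s ⟹ app t z s))) ⋏
    (ball k fun i => fall fun x => isNode 3 c i x ⟹
      (app t c s ⇔ ball m fun s' => agreeOff y k i s s' ⟹ app t x s')) ⋏
    (fall fun z => (isEmpty z ⋏ isNode 4 c z z) ⟹ ∼ (app t c s))

/-- `(y, ∈) ⊨ c`: for some natural number `k` such that `c` is a formula with variables among
`v_i`, `i < k`, the set `m` of all functions from `k` to `y` and a satisfaction relation for the
formulas of a construction of `c` exist, and `c` is satisfied under all assignments in `m`. -/
def models (y c : Fin n) : Fml n :=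
  fex fun k => isNat k ⋏ fex fun w => isConstruction k w ⋏ occurs w c ⋏
    fex fun m => (fall fun s => fmem s m ⇔ isFunction s k y) ⋏
      fex fun t => isSatisfaction y k w m t ⋏ ball m fun s => app t c s

/-- `(y, ∈) ⊨ ZFC`. -/
def modelsZFC (y : Fin n) : Fml n := fall fun c => isZFCAxiom c ⟹ models y c

/-! ## The theory LZFC -/

/-- `Loc(ZFC)`: every set belongs to a transitive set model of ZFC. -/
def locZFC : LSet.Sentence :=
  fall (n := 0) fun x => fex fun y => fmem x y ⋏ isTransitive y ⋏ modelsZFC y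

def LZFC : LSet.Theory := BST ∪ {locZFC}

/-- `∀ x₀ … x_{n-1} ∃ y (x₀ ∈ y ∧ … ∧ x_{n-1} ∈ y ∧ Tr(y) ∧ (y, ∈) ⊨ ZFC)`. -/
noncomputable def tuplesInModels (n : ℕ) : LSet.Sentence :=
  BoundedFormula.alls (n := n) <|
    fex fun y => (BoundedFormula.iInf fun i : Fin n => fmem (i : Fin (n + 1)) y) ⋏
      isTransitive y ⋏ modelsZFC y

end Building

end SetTh

/-!
The proof is semantic. The calculus is sound, and it is complete for countable relational languages
(`Theory.proves_of_forall_realize`, by a Henkin construction), so it suffices to show that the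
sentences in question hold in every structure `M` satisfying LZFC.

For the first claim, pairing and union give in `M` the set of the given elements; a transitive `y`
with this set as an element contains all of them (`exists_transitive_models_ZFC`).

For the second claim, let `y` be a set of `M` of which `M` believes that `(y, ∈)` satisfies ZFC. The
structure `Elements y` of its elements then really is a model of ZFC (`elements_models_ZFC`). Every
standard formula has a code and a construction in `M`, and by induction on the formula any
satisfaction relation of `M` obeying Tarski's clauses agrees with actual satisfaction in
`Elements y` (`mem_satisfaction_iff_eval`). The natural numbers of `M` may be nonstandard, so the
number `k` bounding the variables may be infinite from outside; an external assignment is therefore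
taken eventually constant, and an assignment of `M` extending it arises from a constant function by
finitely many changes (`exists_isFun_extends`), each an instance of bounded separation.

If ZFC proves a `Π₂` sentence, then by soundness it holds in all these structures. Given values in
`M` of its universally quantified variables, a transitive `y` containing them has witnesses for the
existentially quantified ones, and these remain witnesses in `M` because bounded formulas are
absolute for transitive sets (`IsPi2.realize_of_forall_elements`).
-/

/-! ### Renaming of variables -/

section Renaming

open FirstOrder FirstOrder.Language

universe u v u' v'

namespace FirstOrder.Language

variable {L : FirstOrder.Language.{u, v}} {α : Type u'} {β : Type v'} {γ : Type*}

namespace BoundedFormula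

/-- The extension of a renaming of free and bound variables under one more quantifier: the new
bound variable is kept. -/
def liftRenaming {n k : ℕ} (f : α ⊕ Fin n → β ⊕ Fin k) : α ⊕ Fin (n + 1) → β ⊕ Fin (k + 1) :=
  Sum.elim (fun a => Sum.map id Fin.castSucc (f (Sum.inl a)))
    (Fin.lastCases (Sum.inr (Fin.last k)) fun i => Sum.map id Fin.castSucc (f (Sum.inr i)))

/-- Simultaneous renaming of the free variables and the variables bound from outside. Unlike
`relabel` and `subst` it may turn variables of one sort into the other, and a composite of two
renamings is a renaming (`renameVars_renameVars`). -/
def renameVars : ∀ {n k : ℕ}, L.BoundedFormula α n → (α ⊕ Fin n → β ⊕ Fin k) →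
    L.BoundedFormula β k
  | _, _, falsum, _ => falsum
  | _, _, equal t s, f => equal (t.relabel f) (s.relabel f)
  | _, _, rel R ts, f => rel R fun i => (ts i).relabel f
  | _, _, imp φ ψ, f => imp (φ.renameVars f) (ψ.renameVars f)
  | _, _, all φ, f => all (φ.renameVars (liftRenaming f))

theorem liftRenaming_comp {n k l : ℕ} (f : α ⊕ Fin n → β ⊕ Fin k) (g : β ⊕ Fin k → γ ⊕ Fin l) :
    liftRenaming g ∘ liftRenaming f = liftRenaming (g ∘ f) := by
  funext x
  rcases x with a | i
  · simp only [liftRenaming, Function.comp, Sum.elim_inl]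
    rcases f (Sum.inl a) with b | j <;> simp
  · induction i using Fin.lastCases with
    | last => simp [liftRenaming]
    | cast i =>
      simp only [liftRenaming, Function.comp, Sum.elim_inr, Fin.lastCases_castSucc]
      rcases f (Sum.inr i) with b | j <;> simp

theorem renameVars_renameVars {n k l : ℕ} (φ : L.BoundedFormula α n)
    (f : α ⊕ Fin n → β ⊕ Fin k) (g : β ⊕ Fin k → γ ⊕ Fin l) :
    (φ.renameVars f).renameVars g = φ.renameVars (g ∘ f) := by
  induction φ generalizing k l with
  | falsum => rfl
  | equal => simp [renameVars]
  | rel => simp [renameVars]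
  | imp _ _ ih₁ ih₂ => simp [renameVars, ih₁, ih₂]
  | all _ ih => simp [renameVars, ih, liftRenaming_comp]

theorem liftRenaming_id {n : ℕ} : liftRenaming (id : α ⊕ Fin n → α ⊕ Fin n) = id := by
  funext x
  rcases x with a | i
  · rfl
  · induction i using Fin.lastCases <;> simp [liftRenaming]

theorem renameVars_id {n : ℕ} (φ : L.BoundedFormula α n) : φ.renameVars id = φ := by
  induction φ with
  | falsum => rfl
  | equal => simp [renameVars]
  | rel => simp [renameVars]
  | imp _ _ ih₁ ih₂ => simp [renameVars, ih₁, ih₂]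
  | all _ ih => simp [renameVars, liftRenaming_id, ih]

theorem relabel_eq_renameVars {n k : ℕ} (g : α → β ⊕ Fin n) (φ : L.BoundedFormula α k) :
    φ.relabel g = φ.renameVars (relabelAux g k) := by
  induction φ with
  | falsum => rfl
  | equal => rfl
  | rel => rfl
  | imp _ _ ih₁ ih₂ => simp [renameVars, ih₁, ih₂]
  | @all k _ ih =>
    rw [relabel_all, ih, renameVars]
    congr 2
    funext x
    rcases x with a | i
    · simp only [liftRenaming, relabelAux, Function.comp, Sum.elim_inl, Sum.map_inl]
      rcases g a with b | j
      · simp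
      · simp; rfl
    · induction i using Fin.lastCases with
      | last => simp [liftRenaming, relabelAux]
      | cast i => simp [liftRenaming, relabelAux]

theorem toFormula_eq_renameVars {n : ℕ} (φ : L.BoundedFormula α n) :
    φ.toFormula = φ.renameVars (Sum.elim (Sum.inl ∘ Sum.inl) (Sum.inl ∘ Sum.inr)) := by
  induction φ with
  | falsum => rfl
  | equal =>
    simp [toFormula, renameVars, Term.equal, Term.bdEqual]
  | rel =>
    simp [toFormula, renameVars, Relations.formula, Relations.boundedFormula]
  | imp _ _ ih₁ ih₂ => simp [toFormula, renameVars, ih₁, ih₂]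
  | @all k _ ih =>
    rw [toFormula, renameVars, ih, relabel_eq_renameVars]
    erw [renameVars_renameVars]
    congr 2
    funext x
    rcases x with a | i
    · simp [liftRenaming, relabelAux]
    · induction i using Fin.lastCases with
      | last => simp [liftRenaming, relabelAux]; rfl
      | cast i => simp [liftRenaming, relabelAux]

theorem _root_.FirstOrder.Language.Term.subst_var_comp (t : L.Term α) (f : α → β) :
    t.subst (fun a => Term.var (f a)) = t.relabel f := by
  induction t with
  | var => rfl
  | func _ _ ih => simp [Term.subst, ih]

theorem subst_var_eq_renameVars {n : ℕ} (φ : L.BoundedFormula α n) (f : α → β) :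
    (φ.subst fun a => Term.var (f a)) = φ.renameVars (Sum.map f id) := by
  have key : ∀ {n : ℕ} (t : L.Term (α ⊕ Fin n)),
      t.subst (Sum.elim (Term.relabel Sum.inl ∘ fun a => (Term.var (f a) : L.Term β))
        (Term.var ∘ Sum.inr)) = t.relabel (Sum.map f id) := by
    intro n t
    rw [← Term.subst_var_comp]
    congr 1
    funext x
    rcases x with a | i <;> rfl
  have lift : ∀ n : ℕ, liftRenaming (Sum.map f (id : Fin n → Fin n)) = Sum.map f id := by
    intro n
    funext x
    rcases x with a | i
    · rfl
    · induction i using Fin.lastCases <;> simp [liftRenaming]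
  unfold subst
  induction φ with
  | falsum => rfl
  | equal => simp only [mapTermRel, renameVars, key]
  | rel => simp only [mapTermRel, renameVars, key, id]
  | imp _ _ ih₁ ih₂ => simp [mapTermRel, renameVars, ih₁, ih₂]
  | all _ ih => simp [mapTermRel, renameVars, ih, lift]

/-- Instantiation in the calculus, for a variable, as a renaming. -/
theorem instantiate_var_eq_renameVars (φ : L.BoundedFormula ℕ 1) (x : ℕ) :
    φ.instantiate (Term.var x) = φ.renameVars (Sum.elim Sum.inl fun _ => Sum.inl x) := by
  have : (Sum.elim Term.var fun _ => Term.var x : ℕ ⊕ Fin 1 → L.Term ℕ) =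
      fun a => Term.var (Sum.elim id (fun _ => x) a) := by
    funext a; rcases a with a | i <;> rfl
  rw [instantiate, this, subst_var_eq_renameVars, toFormula_eq_renameVars, renameVars_renameVars]
  congr 1
  funext a
  rcases a with a | i <;> rfl

end BoundedFormula

end FirstOrder.Language

end Renaming

section Completeness

open FirstOrder FirstOrder.Language FirstOrder.Language.BoundedFormula

universe u v

namespace FirstOrder.Language.Theory

variable {L : FirstOrder.Language.{u, v}} {T : L.Theory}

/-! ### Soundness -/

theorem _root_.FirstOrder.Language.BoundedFormula.realize_instantiate {M : Type*} [L.Structure M]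
    (φ : L.BoundedFormula ℕ 1) (t : L.Term ℕ) (v : ℕ → M) :
    Formula.Realize (φ.instantiate t) v ↔ φ.Realize v fun _ => t.realize v := by
  rw [instantiate, Formula.Realize, realize_subst]
  refine (realize_toFormula φ _).trans (iff_of_eq ?_)
  congr 1

theorem _root_.FirstOrder.Language.Sentence.realize_toFormulaNat {M : Type*} [L.Structure M]
    (σ : L.Sentence) (v : ℕ → M) : Formula.Realize σ.toFormulaNat v ↔ M ⊨ σ := by
  rw [Sentence.toFormulaNat, Formula.Realize, realize_subst, Sentence.Realize, Formula.Realize]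
  refine iff_of_eq ?_
  congr 1
  exact Subsingleton.elim _ _

theorem _root_.FirstOrder.Language.BoundedFormula.realize_update_of_notMem {M : Type*}
    [L.Structure M] {n : ℕ} (φ : L.BoundedFormula ℕ n) {x : ℕ} (hx : x ∉ φ.freeVarFinset)
    (v : ℕ → M) (a : M) (xs : Fin n → M) :
    φ.Realize (Function.update v x a) xs ↔ φ.Realize v xs := by
  rw [← realize_restrictFreeVar (v := fun i : φ.freeVarFinset => v i) (f := id) v (fun _ => rfl),
    ← realize_restrictFreeVar (v := fun i : φ.freeVarFinset => v i) (f := id)]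
  rintro ⟨i, hi⟩
  exact (Function.update_of_ne (fun h : i = x => hx (h ▸ hi)) _ _).symm

/-- Soundness of the calculus. -/
theorem Derivable.realize {M : Type*} [L.Structure M] (hT : M ⊨ T) {φ : L.Formula ℕ}
    (h : T.Derivable φ) (v : ℕ → M) : φ.Realize v := by
  induction h generalizing v with
  | hyp h => exact (Sentence.realize_toFormulaNat _ v).2 (hT.realize_of_mem _ h)
  | imp_weaken φ ψ => simp only [Formula.realize_imp]; tauto
  | imp_distrib φ ψ χ => simp only [Formula.realize_imp]; tauto
  | double_neg φ => simp only [Formula.realize_imp, Formula.realize_not]; tauto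
  | all_elim φ t =>
    rw [Formula.realize_imp, realize_instantiate, Formula.Realize, realize_all]
    intro h
    convert h (t.realize v)
    simp [Fin.snoc]
  | eq_refl t => simp
  | eq_subst φ s t =>
    simp only [Formula.realize_imp, realize_instantiate, Formula.realize_equal]
    intro h; rw [h]; exact id
  | modus_ponens _ _ h₁ h₂ => exact Formula.realize_imp.1 (h₁ v) (h₂ v)
  | @all_intro φ ψ x hφ hψ _ ih =>
    rw [Formula.realize_imp, Formula.Realize, Formula.Realize, realize_all]
    intro h a
    have h₁ := Formula.realize_imp.1 (ih (Function.update v x a))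
      ((realize_update_of_notMem φ hφ v a _).2 h)
    rw [realize_instantiate, realize_update_of_notMem ψ hψ] at h₁
    convert h₁
    simp [Fin.snoc]

theorem Proves.realize {M : Type*} [L.Structure M] [Nonempty M] (hT : M ⊨ T) {σ : L.Sentence}
    (h : T.Proves σ) : M ⊨ σ :=
  (Sentence.realize_toFormulaNat σ fun _ => Classical.arbitrary M).1 (Derivable.realize hT h _)

/-! ### Propositional derivations -/

/-- Derivability from the theory and a set of assumptions by modus ponens alone, so that free
variables of the assumptions are never generalized and the deduction theorem holds. -/
inductive Entails (T : L.Theory) (Γ : Set (L.Formula ℕ)) : L.Formula ℕ → Prop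
  | of_derivable {φ : L.Formula ℕ} (h : T.Derivable φ) : Entails T Γ φ
  | of_mem {φ : L.Formula ℕ} (h : φ ∈ Γ) : Entails T Γ φ
  | mp {φ ψ : L.Formula ℕ} (h₁ : Entails T Γ (φ.imp ψ)) (h₂ : Entails T Γ φ) : Entails T Γ ψ

namespace Entails

variable {Γ : Set (L.Formula ℕ)} {φ ψ χ : L.Formula ℕ}

theorem deduction (h : Entails T (insert φ Γ) ψ) : Entails T Γ (φ.imp ψ) := by
  induction h with
  | of_derivable h => exact .mp (.of_derivable (.imp_weaken _ _)) (.of_derivable h)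
  | @of_mem χ h =>
    rcases h with rfl | h
    · exact .mp (.mp (.of_derivable (.imp_distrib χ (χ.imp χ) χ))
        (.of_derivable (.imp_weaken _ _))) (.of_derivable (.imp_weaken _ _))
    · exact .mp (.of_derivable (.imp_weaken _ _)) (.of_mem h)
  | mp _ _ h₁ h₂ => exact .mp (.mp (.of_derivable (.imp_distrib _ _ _)) h₁) h₂

theorem mono {Δ : Set (L.Formula ℕ)} (hΓ : Γ ⊆ Δ) (h : Entails T Γ φ) : Entails T Δ φ := by
  induction h with
  | of_derivable h => exact .of_derivable h
  | of_mem h => exact .of_mem (hΓ h)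
  | mp _ _ h₁ h₂ => exact .mp h₁ h₂

theorem derivable (h : Entails T ∅ φ) : T.Derivable φ := by
  induction h with
  | of_derivable h => exact h
  | of_mem h => exact h.elim
  | mp _ _ h₁ h₂ => exact .modus_ponens h₁ h₂

theorem weaken (h : Entails T Γ φ) : Entails T (insert ψ Γ) φ := h.mono (Set.subset_insert _ _)

theorem self : Entails T (insert φ Γ) φ := .of_mem (Set.mem_insert _ _)

theorem by_contradiction (h : Entails T (insert φ.not Γ) ⊥) : Entails T Γ φ :=
  .mp (.of_derivable (.double_neg φ)) h.deduction

theorem of_falsum (h : Entails T Γ ⊥) : Entails T Γ φ := h.weaken.by_contradiction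

end Entails

theorem Derivable.imp_trans {φ ψ χ : L.Formula ℕ} (h₁ : T.Derivable (φ.imp ψ))
    (h₂ : T.Derivable (ψ.imp χ)) : T.Derivable (φ.imp χ) :=
  Entails.derivable (Entails.deduction (.mp (.of_derivable h₂) (.mp (.of_derivable h₁) .self)))

theorem Derivable.of_imp_of_not_imp {χ δ : L.Formula ℕ} (h₁ : T.Derivable (χ.imp δ))
    (h₂ : T.Derivable (χ.not.imp δ)) : T.Derivable δ := by
  refine Entails.derivable (.by_contradiction (.mp .self ?_))
  refine .mp (.of_derivable h₂) (Entails.deduction ?_)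
  exact .mp (Entails.self.weaken) (.mp (.of_derivable h₁) .self)

/-- Adding a Henkin axiom `ψ(x) → ∀ ψ` with a fresh variable `x` is conservative. -/
theorem Derivable.of_henkin_imp {δ : L.Formula ℕ} {ψ : L.BoundedFormula ℕ 1} {x : ℕ}
    (hδ : x ∉ δ.freeVarFinset) (hψ : x ∉ ψ.freeVarFinset)
    (h : T.Derivable (((ψ.instantiate (Term.var x)).imp ψ.all).imp δ)) : T.Derivable δ := by
  have h₁ : T.Derivable (δ.not.imp (ψ.instantiate (Term.var x))) := by
    refine Entails.derivable (Entails.deduction (.by_contradiction (.mp Entails.self.weaken ?_)))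
    exact .mp (.of_derivable h) (Entails.deduction (.of_falsum (.mp Entails.self.weaken .self)))
  have h₂ : T.Derivable (δ.not.imp ψ.all) := by
    refine .all_intro x ?_ hψ h₁
    exact fun h => (Finset.mem_union.1 h).elim hδ (Finset.notMem_empty x)
  refine Entails.derivable (.by_contradiction (.mp .self ?_))
  exact .mp (.of_derivable h) (Entails.deduction (.weaken (.mp (.of_derivable h₂) .self)))

/-! ### The Henkin construction -/

/-- `H` is a complete, deductively closed, consistent set of formulas such that every universal
formula has a variable for which it fails if it fails at all. -/
structure IsHenkin (T : L.Theory) (H : Set (L.Formula ℕ)) : Prop where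
  of_derivable {φ : L.Formula ℕ} : T.Derivable φ → φ ∈ H
  mp {φ ψ : L.Formula ℕ} : φ.imp ψ ∈ H → φ ∈ H → ψ ∈ H
  consistent : (⊥ : L.Formula ℕ) ∉ H
  complete (φ : L.Formula ℕ) : φ ∈ H ∨ φ.not ∈ H
  witness (ψ : L.BoundedFormula ℕ 1) : ∃ x, (ψ.instantiate (Term.var x)).imp ψ.all ∈ H

/-- One step of the construction. The formulas accepted so far are those derivable from `¬ δ`, so
consistency means that `δ` is not derivable. -/
theorem exists_henkin_step {δ : L.Formula ℕ} (hδ : ¬ T.Derivable δ) (χ : L.Formula ℕ)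
    (ψ : L.BoundedFormula ℕ 1) :
    ∃ δ' : L.Formula ℕ, ¬ T.Derivable δ' ∧ T.Derivable (δ'.not.imp δ.not) ∧
      (T.Derivable (δ'.not.imp χ) ∨ T.Derivable (δ'.not.imp χ.not)) ∧
      ∃ x, T.Derivable (δ'.not.imp ((ψ.instantiate (Term.var x)).imp ψ.all)) := by
  have take : ∀ χ δ : L.Formula ℕ, T.Derivable ((χ.imp δ).not.imp χ) := fun χ δ => by
    refine Entails.derivable (Entails.deduction (.by_contradiction (.mp Entails.self.weaken ?_)))
    exact Entails.deduction (.of_falsum (.mp Entails.self.weaken .self))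
  have keep : ∀ χ δ : L.Formula ℕ, T.Derivable ((χ.imp δ).not.imp δ.not) := fun χ δ => by
    refine Entails.derivable (Entails.deduction (Entails.deduction
      (.mp Entails.self.weaken (Entails.deduction Entails.self.weaken))))
  obtain ⟨δ₁, hδ₁, h₁, h₂⟩ : ∃ δ₁ : L.Formula ℕ, ¬ T.Derivable δ₁ ∧
      T.Derivable (δ₁.not.imp δ.not) ∧
      (T.Derivable (δ₁.not.imp χ) ∨ T.Derivable (δ₁.not.imp χ.not)) := by
    by_cases h : T.Derivable (χ.imp δ)
    · exact ⟨χ.not.imp δ, fun h' => hδ (.of_imp_of_not_imp h h'), keep _ _, .inr (take _ _)⟩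
    · exact ⟨χ.imp δ, h, keep _ _, .inl (take _ _)⟩
  obtain ⟨x, hx⟩ := Infinite.exists_notMem_finset (δ₁.freeVarFinset ∪ ψ.freeVarFinset)
  rw [Finset.mem_union, not_or] at hx
  refine ⟨((ψ.instantiate (Term.var x)).imp ψ.all).imp δ₁,
    fun h => hδ₁ (.of_henkin_imp hx.1 hx.2 h), .imp_trans (keep _ _) h₁,
    h₂.imp (.imp_trans (keep _ _)) (.imp_trans (keep _ _)), x, take _ _⟩

/-- Every underivable formula is refuted by a Henkin set: all pairs of a formula to be decided and a
quantified formula to be given a witness are handled in turn. -/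
theorem exists_isHenkin [Countable L.Symbols] {δ : L.Formula ℕ} (hδ : ¬ T.Derivable δ) :
    ∃ H, IsHenkin T H ∧ δ.not ∈ H := by
  have : Countable (L.BoundedFormula ℕ 1) :=
    (sigma_mk_injective : Function.Injective
      (Sigma.mk 1 : L.BoundedFormula ℕ 1 → Σ n, L.BoundedFormula ℕ n)).countable
  have : Nonempty (L.Formula ℕ × L.BoundedFormula ℕ 1) := ⟨⊥, ⊥⟩
  obtain ⟨e, he⟩ := exists_surjective_nat (L.Formula ℕ × L.BoundedFormula ℕ 1)
  choose next h_next using fun (δ : {δ : L.Formula ℕ // ¬ T.Derivable δ})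
    (p : L.Formula ℕ × L.BoundedFormula ℕ 1) => exists_henkin_step δ.2 p.1 p.2
  let s : ℕ → {δ : L.Formula ℕ // ¬ T.Derivable δ} := fun n =>
    Nat.rec ⟨δ, hδ⟩ (fun n δ => ⟨next δ (e n), (h_next δ (e n)).1⟩) n
  have hs : ∀ n, T.Derivable ((s (n + 1)).1.not.imp (s n).1.not) ∧
      (T.Derivable ((s (n + 1)).1.not.imp (e n).1) ∨
        T.Derivable ((s (n + 1)).1.not.imp (e n).1.not)) ∧
      ∃ x, T.Derivable ((s (n + 1)).1.not.imp
        (((e n).2.instantiate (Term.var x)).imp (e n).2.all)) := fun n => (h_next (s n) (e n)).2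
  have refl : ∀ φ : L.Formula ℕ, T.Derivable (φ.imp φ) :=
    fun φ => Entails.derivable (Entails.deduction .self)
  have mono : ∀ {m n}, m ≤ n → T.Derivable ((s n).1.not.imp (s m).1.not) := fun {m n} h => by
    induction n, h using Nat.le_induction with
    | base => exact refl _
    | succ n _ ih => exact .imp_trans (hs n).1 ih
  refine ⟨{φ | ∃ n, T.Derivable ((s n).1.not.imp φ)}, ⟨?_, ?_, ?_, ?_, ?_⟩, 0, refl _⟩
  · exact fun h => ⟨0, .modus_ponens (.imp_weaken _ _) h⟩
  · rintro φ ψ ⟨m, hm⟩ ⟨n, hn⟩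
    refine ⟨max m n, .modus_ponens (.modus_ponens (.imp_distrib _ _ _) ?_)
      (.imp_trans (mono (le_max_right m n)) hn)⟩
    exact .imp_trans (mono (le_max_left m n)) hm
  · rintro ⟨n, hn⟩
    exact (s n).2 (.modus_ponens (.double_neg _) hn)
  · intro φ
    obtain ⟨n, hn⟩ := he (φ, ⊥)
    have := (hs n).2.1
    rw [hn] at this
    exact this.imp (fun h => ⟨n + 1, h⟩) fun h => ⟨n + 1, h⟩
  · intro ψ
    obtain ⟨n, hn⟩ := he (⊥, ψ)
    obtain ⟨x, hx⟩ := (hs n).2.2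
    rw [hn] at hx
    exact ⟨x, n + 1, hx⟩

/-- `φ(f 0, …, f (n - 1))`: variables are put for the variables bound from outside. -/
abbrev _root_.FirstOrder.Language.BoundedFormula.putVars {n : ℕ} (φ : L.BoundedFormula ℕ n)
    (f : Fin n → ℕ) : L.Formula ℕ :=
  φ.renameVars (Sum.elim Sum.inl (Sum.inl ∘ f))

namespace IsHenkin

variable {H : Set (L.Formula ℕ)} (hH : IsHenkin T H)

include hH

theorem imp_mem_iff {φ ψ : L.Formula ℕ} : φ.imp ψ ∈ H ↔ (φ ∈ H → ψ ∈ H) := by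
  refine ⟨hH.mp, fun h => ?_⟩
  rcases hH.complete φ with hφ | hφ
  · exact hH.mp (hH.of_derivable (.imp_weaken _ _)) (h hφ)
  · refine hH.mp (hH.of_derivable (Entails.derivable (Entails.deduction (Entails.deduction
      (.of_falsum (.mp Entails.self.weaken .self))))) ) hφ

theorem all_mem_iff {ψ : L.BoundedFormula ℕ 1} :
    ψ.all ∈ H ↔ ∀ x : ℕ, ψ.instantiate (Term.var x) ∈ H := by
  refine ⟨fun h x => hH.mp (hH.of_derivable (.all_elim _ _)) h, fun h => ?_⟩
  obtain ⟨x, hx⟩ := hH.witness ψ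
  exact hH.mp hx (h x)

/-- Accepted formulas are closed under replacing one variable by an equal one: the other variables
are kept as free variables in an instance of the substitution axiom. -/
theorem putVars_update_mem {n : ℕ} (φ : L.BoundedFormula ℕ n) {f : Fin n → ℕ} {i : Fin n}
    {y : ℕ} (h : (Term.var (f i)).equal (Term.var y) ∈ H) (hφ : φ.putVars f ∈ H) :
    φ.putVars (Function.update f i y) ∈ H := by
  let ψ : L.BoundedFormula ℕ 1 := φ.renameVars
    (Sum.elim Sum.inl fun j => if j = i then Sum.inr 0 else Sum.inl (f j))
  have hψ : ∀ z, ψ.instantiate (Term.var z) = φ.putVars (Function.update f i z) := fun z => by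
    rw [instantiate_var_eq_renameVars, renameVars_renameVars]
    congr 1
    funext a
    rcases a with a | j
    · rfl
    · by_cases hj : j = i
      · subst hj; simp
      · simp [hj]
  rw [← hψ]
  refine hH.mp (hH.mp (hH.of_derivable (.eq_subst ψ _ _)) h) ?_
  rwa [hψ, Function.update_eq_self]

theorem equal_refl (x : ℕ) : (Term.var x : L.Term ℕ).equal (Term.var x) ∈ H :=
  hH.of_derivable (.eq_refl _)

theorem equal_symm {x y : ℕ} (h : (Term.var x : L.Term ℕ).equal (Term.var y) ∈ H) :
    (Term.var y : L.Term ℕ).equal (Term.var x) ∈ H := by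
  have := hH.putVars_update_mem (n := 2) (.equal (.var (.inr 0)) (.var (.inr 1)))
    (f := ![x, x]) (i := 0) h (hH.equal_refl x)
  simpa [renameVars, Term.equal, Term.bdEqual] using this

theorem equal_trans {x y z : ℕ} (h₁ : (Term.var x : L.Term ℕ).equal (Term.var y) ∈ H)
    (h₂ : (Term.var y : L.Term ℕ).equal (Term.var z) ∈ H) :
    (Term.var x : L.Term ℕ).equal (Term.var z) ∈ H := by
  have := hH.putVars_update_mem (n := 2) (.equal (.var (.inr 0)) (.var (.inr 1)))
    (f := ![x, y]) (i := 1) h₂ h₁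
  simpa [renameVars, Term.equal, Term.bdEqual] using this

theorem putVars_mem_of_equal {n : ℕ} (φ : L.BoundedFormula ℕ n) {f g : Fin n → ℕ}
    (h : ∀ i, (Term.var (f i)).equal (Term.var (g i)) ∈ H) (hφ : φ.putVars f ∈ H) :
    φ.putVars g ∈ H := by
  have key : ∀ s : Finset (Fin n), φ.putVars (s.piecewise g f) ∈ H := fun s => by
    induction s using Finset.induction_on with
    | empty => simpa using hφ
    | insert i s hi ih =>
      rw [Finset.piecewise_insert]
      exact hH.putVars_update_mem φ (by simpa [hi] using h i) ih
  simpa using key Finset.univ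

/-- Variables are identified if their equality was accepted. -/
def setoid : Setoid ℕ where
  r x y := (Term.var x : L.Term ℕ).equal (Term.var y) ∈ H
  iseqv := ⟨hH.equal_refl, hH.equal_symm, hH.equal_trans⟩

/-- The term model; the terms of a relational language are its variables. -/
@[reducible]
noncomputable def termModel [L.IsRelational] : L.Structure (Quotient hH.setoid) where
  funMap f := isEmptyElim f
  RelMap R xs := (BoundedFormula.rel R fun i => Term.var (Sum.inr i)).putVars
    (fun i => (xs i).out) ∈ H

/-- The truth lemma: in the term model, under the assignment of its own class to every variable,
exactly the accepted formulas hold. -/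
theorem realize_termModel_iff [L.IsRelational] {n : ℕ} (φ : L.BoundedFormula ℕ n)
    (f : Fin n → ℕ) :
    letI := hH.termModel
    φ.Realize (Quotient.mk hH.setoid) (Quotient.mk hH.setoid ∘ f) ↔ φ.putVars f ∈ H := by
  let := hH.termModel
  have term : ∀ {n : ℕ} (t : L.Term (ℕ ⊕ Fin n)) (f : Fin n → ℕ),
      ∃ x : ℕ, t.relabel (Sum.elim Sum.inl (Sum.inl ∘ f)) =
          (Term.var (Sum.inl x) : L.Term (ℕ ⊕ Fin 0)) ∧
        t.realize (Sum.elim (Quotient.mk hH.setoid) (Quotient.mk hH.setoid ∘ f)) =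
          Quotient.mk hH.setoid x := by
    rintro n (a | F) f
    · rcases a with a | i
      · exact ⟨a, rfl, rfl⟩
      · exact ⟨f i, rfl, rfl⟩
    · exact isEmptyElim F
  induction φ with
  | falsum => exact iff_of_false id hH.consistent
  | equal t s =>
    obtain ⟨x, hx, hx'⟩ := term t f
    obtain ⟨y, hy, hy'⟩ := term s f
    rw [BoundedFormula.Realize, hx', hy', putVars, renameVars, hx, hy]
    exact Quotient.eq
  | rel R ts =>
    choose x hx hx' using fun i => term (ts i) f
    rw [BoundedFormula.Realize]
    simp only [hx', putVars, renameVars, hx]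
    have e : ∀ g, (BoundedFormula.rel R fun i => Term.var (Sum.inr i)).putVars g =
        (BoundedFormula.rel R fun i => Term.var (Sum.inl (g i)) : L.Formula ℕ) := fun g => rfl
    rw [← e]
    exact ⟨hH.putVars_mem_of_equal _ fun i => Quotient.mk_out (s := hH.setoid) (x i),
      hH.putVars_mem_of_equal _ fun i => hH.equal_symm (Quotient.mk_out (s := hH.setoid) (x i))⟩
  | imp φ ψ ih₁ ih₂ => exact (imp_congr (ih₁ f) (ih₂ f)).trans hH.imp_mem_iff.symm
  | all φ ih =>
    refine (Quotient.mk_surjective.forall.trans (forall_congr' fun x => ?_)).trans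
      hH.all_mem_iff.symm
    rw [← Fin.comp_snoc]
    refine (ih (Fin.snoc f x)).trans ?_
    rw [ instantiate_var_eq_renameVars, renameVars_renameVars]
    refine iff_of_eq ?_
    congr 1
    refine congrArg φ.renameVars (funext fun a => ?_)
    rcases a with a | i
    · rfl
    · induction i using Fin.lastCases <;> simp [liftRenaming]

end IsHenkin

/-- Gödel's completeness theorem for the calculus, for countable relational languages. -/
theorem proves_of_forall_realize {L : FirstOrder.Language.{0, 0}} [L.IsRelational]
    [Countable L.Symbols] {T : L.Theory} {σ : L.Sentence}
    (h : ∀ (M : Type) [L.Structure M] [Nonempty M], M ⊨ T → M ⊨ σ) : T.Proves σ := by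
  by_contra hσ
  obtain ⟨H, hH, h_not⟩ := exists_isHenkin hσ
  let := hH.termModel
  have key : ∀ τ : L.Sentence, Quotient hH.setoid ⊨ τ ↔ τ.toFormulaNat ∈ H := fun τ => by
    rw [← Sentence.realize_toFormulaNat τ (Quotient.mk hH.setoid)]
    have := hH.realize_termModel_iff τ.toFormulaNat Fin.elim0
    rw [putVars, show (Sum.elim Sum.inl (Sum.inl ∘ Fin.elim0) : ℕ ⊕ Fin 0 → ℕ ⊕ Fin 0) = id from
      funext fun a => by rcases a with a | i; exacts [rfl, i.elim0], renameVars_id] at this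
    rw [← this, Formula.Realize]
    exact iff_of_eq (congrArg _ (Subsingleton.elim _ _))
  have : Nonempty (Quotient hH.setoid) := ⟨Quotient.mk _ 0⟩
  have hT : Quotient hH.setoid ⊨ T := ⟨fun τ hτ => (key τ).2 (hH.of_derivable (.hyp hτ))⟩
  exact hH.consistent (hH.mp h_not ((key σ).1 (h _ hT)))

end FirstOrder.Language.Theory

end Completeness

namespace SetTh

open FirstOrder FirstOrder.Language

/-! ### Models of basic set theory -/

instance : LSet.IsRelational := fun _ => inferInstanceAs (IsEmpty Empty)

instance : Countable LSet.Symbols := by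
  have : Countable (Σ n, MemRel n) :=
    Function.Injective.countable (f := fun _ => ()) (by rintro ⟨_, ⟨⟩⟩ ⟨_, ⟨⟩⟩ _; rfl)
  exact inferInstanceAs (Countable ((Σ _ : ℕ, Empty) ⊕ Σ n, MemRel n))

section Realize

variable {M : Type*} [LSet.Structure M] {n : ℕ} {v : Empty → M} {xs : Fin n → M}

/-- The interpretation of `∈` in a structure. -/
def Mem (a b : M) : Prop :=
  Structure.RelMap (L := LSet) (MemRel.mem : LSet.Relations 2) ![a, b]

local infix:50 " ε " => Mem

@[simp]
theorem realize_fmem {i j : Fin n} : (fmem i j).Realize v xs ↔ xs i ε xs j :=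
  BoundedFormula.realize_rel₂

@[simp]
theorem realize_feq {i j : Fin n} : (feq i j).Realize v xs ↔ xs i = xs j := by simp [feq]

@[simp]
theorem realize_fall {f : Fin (n + 1) → Fml (n + 1)} :
    (fall f).Realize v xs ↔ ∀ a, (f (Fin.last n)).Realize v (Fin.snoc xs a) :=
  BoundedFormula.realize_all

@[simp]
theorem realize_fex {f : Fin (n + 1) → Fml (n + 1)} :
    (fex f).Realize v xs ↔ ∃ a, (f (Fin.last n)).Realize v (Fin.snoc xs a) :=
  BoundedFormula.realize_ex

@[simp]
theorem realize_ball {i : Fin n} {f : Fin (n + 1) → Fml (n + 1)} :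
    (ball i f).Realize v xs ↔ ∀ a, a ε xs i → (f (Fin.last n)).Realize v (Fin.snoc xs a) := by
  simp [ball]

@[simp]
theorem realize_bex {i : Fin n} {f : Fin (n + 1) → Fml (n + 1)} :
    (bex i f).Realize v xs ↔ ∃ a, a ε xs i ∧ (f (Fin.last n)).Realize v (Fin.snoc xs a) := by
  simp [bex]

@[simp]
theorem realize_rename {m : ℕ} {ψ : Fml m} {z : Fin m → Fin n} :
    (rename ψ z).Realize v xs ↔ ψ.Realize v (xs ∘ z) := by
  rw [rename]
  refine BoundedFormula.realize_relabel.trans ((BoundedFormula.realize_toFormula ψ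
    (Sum.elim v (xs ∘ z))).symm.trans (iff_of_eq ?_)).symm
  unfold Formula.Realize
  congr 1
  · funext a
    rcases a with a | i
    · exact a.elim
    · rfl
  · exact Subsingleton.elim _ _

theorem realize_sentence_iff {σ : LSet.Sentence} (v : Empty → M) (xs : Fin 0 → M) :
    BoundedFormula.Realize σ v xs ↔ M ⊨ σ := by
  rw [Sentence.Realize, Formula.Realize, Subsingleton.elim v default, Subsingleton.elim xs default]

theorem realize_separation {ψ : Fml (n + 1)} :
    M ⊨ separation n ψ ↔ ∀ (z : Fin n → M) (a : M), ∃ b, ∀ y,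
      y ε b ↔ y ε a ∧ ψ.Realize default (Fin.snoc z y) := by
  rw [separation, Sentence.Realize, BoundedFormula.realize_alls]
  refine forall_congr' fun z => ?_
  simp only [realize_fall, realize_fex, BoundedFormula.realize_iff, realize_fmem,
    BoundedFormula.realize_inf, realize_rename, Fin.snoc_last, Fin.snoc_castSucc]
  refine forall_congr' fun a => exists_congr fun b => forall_congr' fun y =>
    iff_congr Iff.rfl (and_congr Iff.rfl (iff_of_eq ?_))
  congr 1
  funext i
  induction i using Fin.lastCases <;> simp

theorem realize_replacement {ψ : Fml (n + 2)} :
    M ⊨ replacement n ψ ↔ ∀ (z : Fin n → M) (a : M),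
      (∀ x, x ε a → ∃ u, ∀ y, ψ.Realize default (Fin.snoc (Fin.snoc z x : Fin (n + 1) → M) y) ↔
        y = u) →
      ∃ b, ∀ x, x ε a → ∃ y, y ε b ∧
        ψ.Realize default (Fin.snoc (Fin.snoc z x : Fin (n + 1) → M) y) := by
  have key : ∀ (z : Fin n → M) (a b x y : M),
      (Fin.snoc (Fin.snoc (Fin.snoc (Fin.snoc z a : Fin (n + 1) → M) x : Fin (n + 2) → M) b :
        Fin (n + 3) → M) y : Fin (n + 4) → M) ∘
        (Fin.lastCases (motive := fun _ => Fin (n + 4)) (Fin.last (n + 3))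
          (Fin.lastCases (motive := fun _ => Fin (n + 4)) (Fin.last (n + 1)).castSucc.castSucc
            fun i : Fin n => i.castSucc.castSucc.castSucc.castSucc)) =
      Fin.snoc (Fin.snoc z x : Fin (n + 1) → M) y := fun z a b x y => by
    funext i
    induction i using Fin.lastCases with
    | last => simp
    | cast i => induction i using Fin.lastCases <;> simp
  have key' : ∀ (z : Fin n → M) (a b x y : M),
      (Fin.snoc (Fin.snoc (Fin.snoc (Fin.snoc z a : Fin (n + 1) → M) b : Fin (n + 2) → M) x :
        Fin (n + 3) → M) y : Fin (n + 4) → M) ∘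
        (Fin.lastCases (motive := fun _ => Fin (n + 4)) (Fin.last (n + 3))
          (Fin.lastCases (motive := fun _ => Fin (n + 4)) (Fin.last (n + 2)).castSucc
            fun i : Fin n => i.castSucc.castSucc.castSucc.castSucc)) =
      Fin.snoc (Fin.snoc z x : Fin (n + 1) → M) y := fun z a b x y => by
    funext i
    induction i using Fin.lastCases with
    | last => simp
    | cast i => induction i using Fin.lastCases <;> simp
  rw [replacement, Sentence.Realize, BoundedFormula.realize_alls]
  refine forall_congr' fun z => ?_
  simp only [realize_fall, realize_fex, realize_ball, realize_bex, BoundedFormula.realize_iff,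
    realize_feq, BoundedFormula.realize_imp, realize_rename, Fin.snoc_last, Fin.snoc_castSucc,
    key, key']

end Realize

section BST

variable {M : Type*} [LSet.Structure M]

local infix:50 " ε " => Mem

theorem realize_of_mem_BST [M ⊨ BST] {σ : LSet.Sentence}
    (h : σ ∈ [emptyset, extensionality, pairing, union, cartesianProduct, infinity]) : M ⊨ σ :=
  Theory.realize_sentence_of_mem BST (Or.inl h)

variable [M ⊨ BST]

theorem mem_ext {x y : M} (h : ∀ z, z ε x ↔ z ε y) : x = y := by
  have := realize_of_mem_BST (M := M) (σ := extensionality) (by simp)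
  simp [extensionality, Sentence.Realize, Formula.Realize] at this
  exact this x y h

theorem exists_forall_not_mem : ∃ e : M, ∀ z, ¬ z ε e := by
  have := realize_of_mem_BST (M := M) (σ := emptyset) (by simp)
  simpa only [emptyset, isEmpty, Sentence.Realize, Formula.Realize, realize_fex, realize_fall,
    BoundedFormula.realize_not, realize_fmem, Fin.snoc_last, Fin.snoc_castSucc] using this

theorem exists_mem_iff_eq_or_eq (x y : M) : ∃ p : M, ∀ z, z ε p ↔ z = x ∨ z = y := by
  have := realize_of_mem_BST (M := M) (σ := pairing) (by simp)
  simp [pairing, isUPair, Sentence.Realize, Formula.Realize] at this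
  obtain ⟨p, hx, hy, h⟩ := this x y
  exact ⟨p, fun z => ⟨h z, by rintro (rfl | rfl) <;> assumption⟩⟩

theorem exists_mem_iff_exists_mem (x : M) : ∃ u : M, ∀ z, z ε u ↔ ∃ y, y ε x ∧ z ε y := by
  have := realize_of_mem_BST (M := M) (σ := union) (by simp)
  simp [union, isUnion, subset, Sentence.Realize, Formula.Realize] at this
  obtain ⟨u, h₁, h₂⟩ := this x
  exact ⟨u, fun z => ⟨h₂ z, fun ⟨y, hy, hz⟩ => h₁ y hy z hz⟩⟩

variable (M) in
/-- The empty set of a model. -/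
noncomputable def mEmpty : M := exists_forall_not_mem.choose

@[simp]
theorem not_mem_mEmpty {z : M} : ¬ z ε mEmpty M := exists_forall_not_mem.choose_spec z

/-- The unordered pair in a model. -/
noncomputable def upair (x y : M) : M := (exists_mem_iff_eq_or_eq x y).choose

@[simp]
theorem mem_upair {x y z : M} : z ε upair x y ↔ z = x ∨ z = y :=
  (exists_mem_iff_eq_or_eq x y).choose_spec z

/-- The union of two sets in a model. -/
noncomputable def mUnion (x y : M) : M := (exists_mem_iff_exists_mem (upair x y)).choose

@[simp]
theorem mem_mUnion {x y z : M} : z ε mUnion x y ↔ z ε x ∨ z ε y := by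
  rw [mUnion, (exists_mem_iff_exists_mem (upair x y)).choose_spec z]
  simp

/-- The Kuratowski pair in a model. -/
noncomputable def pr (x y : M) : M := upair (upair x x) (upair x y)

theorem upair_inj_right {x y z : M} (h : upair x y = upair x z) : y = z := by
  have h₁ : y ε upair x z := h ▸ mem_upair.2 (.inr rfl)
  have h₂ : z ε upair x y := h ▸ mem_upair.2 (.inr rfl)
  rw [mem_upair] at h₁ h₂
  rcases h₁ with h₁ | h₁
  · rcases h₂ with h₂ | h₂
    · rw [h₁, h₂]
    · exact h₂.symm
  · exact h₁

theorem upair_self_eq {x y z : M} (h : upair x x = upair y z) : x = y := by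
  have h₁ : y ε upair x x := h ▸ mem_upair.2 (.inl rfl)
  simpa [eq_comm] using h₁

@[simp]
theorem pr_inj {x y x' y' : M} : pr x y = pr x' y' ↔ x = x' ∧ y = y' := by
  refine ⟨fun h => ?_, by rintro ⟨rfl, rfl⟩; rfl⟩
  obtain rfl : x = x' := by
    have h₁ : upair x x ε pr x' y' := h ▸ mem_upair.2 (.inl rfl)
    rcases mem_upair.1 h₁ with h₁ | h₁ <;> exact upair_self_eq h₁
  exact ⟨rfl, upair_inj_right (upair_inj_right h)⟩

/-- The successor `x ∪ {x}` in a model. -/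
noncomputable def mSucc (x : M) : M := mUnion x (upair x x)

@[simp]
theorem mem_mSucc {x z : M} : z ε mSucc x ↔ z ε x ∨ z = x := by simp [mSucc]

variable (M) in
/-- The standard natural numbers of a model. -/
noncomputable def num : ℕ → M
  | 0 => mEmpty M
  | k + 1 => mSucc (num k)

theorem mem_num {k : ℕ} {z : M} : z ε num M k ↔ ∃ j < k, z = num M j := by
  induction k with
  | zero => simp [num]
  | succ k ih =>
    simp only [num, mem_mSucc, ih, Nat.lt_succ_iff_lt_or_eq]
    constructor
    · rintro (⟨j, hj, rfl⟩ | rfl)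
      exacts [⟨j, .inl hj, rfl⟩, ⟨k, .inr rfl, rfl⟩]
    · rintro ⟨j, hj | rfl, rfl⟩
      exacts [.inl ⟨j, hj, rfl⟩, .inr rfl]

theorem num_mem_num {j k : ℕ} (h : j < k) : num M j ε num M k := mem_num.2 ⟨j, h, rfl⟩

theorem not_num_mem_self (k : ℕ) : ¬ num M k ε num M k := by
  induction k using Nat.strong_induction_on with
  | _ k ih =>
    intro h
    obtain ⟨j, hj, e⟩ := mem_num.1 h
    exact ih j hj (by simpa [e] using num_mem_num (M := M) hj)

@[simp]
theorem num_inj {j k : ℕ} : num M j = num M k ↔ j = k := by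
  refine ⟨fun h => ?_, by rintro rfl; rfl⟩
  rcases lt_trichotomy j k with hjk | rfl | hjk
  · exact (not_num_mem_self k (h.subst (motive := fun x => x ε num M k) (num_mem_num hjk))).elim
  · rfl
  · exact (not_num_mem_self k (h.subst (motive := fun x => num M k ε x) (num_mem_num hjk))).elim

theorem exists_mem_iff_mem_list (l : List M) : ∃ a : M, ∀ z, z ε a ↔ z ∈ l := by
  induction l with
  | nil => exact ⟨mEmpty M, by simp⟩
  | cons x l ih =>
    obtain ⟨a, ha⟩ := ih
    exact ⟨mUnion (upair x x) a, by simp [ha]⟩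

theorem exists_separation {n : ℕ} {ψ : Fml (n + 1)} (hψ : IsDelta0 ψ) (z : Fin n → M) (a : M) :
    ∃ b, ∀ y, y ε b ↔ y ε a ∧ ψ.Realize default (Fin.snoc z y) :=
  realize_separation.1 (Theory.realize_sentence_of_mem BST (Or.inr ⟨n, ψ, hψ, rfl⟩)) z a

section Realize

variable {n : ℕ} {v : Empty → M} {xs : Fin n → M}

@[simp]
theorem realize_isEmpty {x : Fin n} : (isEmpty x).Realize v xs ↔ xs x = mEmpty M := by
  simp only [isEmpty, realize_fall, BoundedFormula.realize_not, realize_fmem, Fin.snoc_last,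
    Fin.snoc_castSucc]
  exact ⟨fun h => mem_ext (by simp [h]), fun h => by simp [h]⟩

omit [M ⊨ BST] in
@[simp]
theorem realize_subset {x y : Fin n} :
    (subset x y).Realize v xs ↔ ∀ z, z ε xs x → z ε xs y := by
  simp [subset]

omit [M ⊨ BST] in
@[simp]
theorem realize_isTransitive {x : Fin n} :
    (isTransitive x).Realize v xs ↔ ∀ z, z ε xs x → ∀ t, t ε z → t ε xs x := by
  simp [isTransitive]

@[simp]
theorem realize_isUPair {p x y : Fin n} :
    (isUPair p x y).Realize v xs ↔ xs p = upair (xs x) (xs y) := by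
  simp only [isUPair, BoundedFormula.realize_inf, realize_fmem, realize_ball, realize_feq,
    BoundedFormula.realize_sup, Fin.snoc_last, Fin.snoc_castSucc]
  constructor
  · rintro ⟨h₁, h₂, h₃⟩
    refine mem_ext fun z => ?_
    rw [mem_upair]
    exact ⟨h₃ z, by rintro (rfl | rfl) <;> assumption⟩
  · intro h
    simp [h]

@[simp]
theorem realize_isOPair {p x y : Fin n} :
    (isOPair p x y).Realize v xs ↔ xs p = pr (xs x) (xs y) := by
  simp only [isOPair, realize_bex, BoundedFormula.realize_inf, realize_isUPair, Fin.snoc_last,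
    Fin.snoc_castSucc]
  constructor
  · rintro ⟨_, _, _, _, rfl, rfl, h⟩
    exact h
  · intro h
    exact ⟨_, by simp [h, pr], _, by simp [h, pr], rfl, rfl, h⟩

@[simp]
theorem realize_isTriple {t x y z : Fin n} :
    (isTriple t x y z).Realize v xs ↔ xs t = pr (xs x) (pr (xs y) (xs z)) := by
  simp only [isTriple, realize_bex, BoundedFormula.realize_inf, realize_isOPair, Fin.snoc_last,
    Fin.snoc_castSucc]
  constructor
  · rintro ⟨_, _, _, _, rfl, h⟩
    exact h
  · intro h
    exact ⟨upair (xs x) (pr (xs y) (xs z)), by simp [h, pr], _, by simp, rfl, h⟩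

@[simp]
theorem realize_isSucc {s x : Fin n} :
    (isSucc s x).Realize v xs ↔ xs s = mSucc (xs x) := by
  simp only [isSucc, BoundedFormula.realize_inf, realize_fmem, realize_subset, realize_ball,
    BoundedFormula.realize_sup, realize_feq, Fin.snoc_last, Fin.snoc_castSucc]
  constructor
  · rintro ⟨h₁, h₂, h₃⟩
    refine mem_ext fun z => ?_
    rw [mem_mSucc]
    exact ⟨h₃ z, by rintro (h | rfl); exacts [h₂ z h, h₁]⟩
  · intro h
    simp +contextual [h]

@[simp]
theorem realize_isNum {k : ℕ} {x : Fin n} : (isNum k x).Realize v xs ↔ xs x = num M k := by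
  induction k generalizing n with
  | zero => simp [isNum, num]
  | succ k ih => simp [isNum, num, ih]

@[simp]
theorem realize_app {s i a : Fin n} : (app s i a).Realize v xs ↔ pr (xs i) (xs a) ε xs s := by
  simp [app]

theorem realize_isNat_of_eq_num {k : ℕ} {x : Fin n} (h : xs x = num M k) :
    (isNat x).Realize v xs := by
  have tr : ∀ j (z t : M), z ε num M j → t ε z → t ε num M j := by
    intro j z t hz ht
    obtain ⟨i, hi, rfl⟩ := mem_num.1 hz
    obtain ⟨i', hi', rfl⟩ := mem_num.1 ht
    exact num_mem_num (hi'.trans hi)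
  have zs : ∀ j, num M j = mEmpty M ∨ ∃ y, y ε num M j ∧ num M j = mSucc y := by
    rintro (_ | j)
    exacts [.inl rfl, .inr ⟨num M j, num_mem_num j.lt_succ_self, rfl⟩]
  simp only [isNat, isOrdinal, BoundedFormula.realize_inf, BoundedFormula.realize_sup,
    realize_isTransitive, realize_ball, realize_bex, BoundedFormula.realize_not, realize_fmem,
    realize_feq, realize_isEmpty, realize_isSucc, Fin.snoc_last, Fin.snoc_castSucc, h]
  refine ⟨⟨fun z hz t => tr k z t hz, ?_, ?_, ?_⟩, zs k, ?_⟩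
  · intro y hy
    obtain ⟨j, -, rfl⟩ := mem_num.1 hy
    exact fun z hz t => tr j z t hz
  · intro y hy
    obtain ⟨j, -, rfl⟩ := mem_num.1 hy
    exact not_num_mem_self j
  · intro y hy z hz
    obtain ⟨i, -, rfl⟩ := mem_num.1 hy
    obtain ⟨j, -, rfl⟩ := mem_num.1 hz
    rcases lt_trichotomy i j with hij | rfl | hij
    exacts [.inl (num_mem_num hij), .inr (.inl rfl), .inr (.inr (num_mem_num hij))]
  · intro y hy
    obtain ⟨j, -, rfl⟩ := mem_num.1 hy
    exact zs j

/-- The code `(k, x, y)` in a model. -/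
noncomputable def node (k : ℕ) (x y : M) : M := pr (num M k) (pr x y)

@[simp]
theorem node_inj {k l : ℕ} {x y x' y' : M} :
    node k x y = node l x' y' ↔ k = l ∧ x = x' ∧ y = y' := by
  simp [node]

@[simp]
theorem realize_isNode {k : ℕ} {c x y : Fin n} :
    (isNode k c x y).Realize v xs ↔ xs c = node k (xs x) (xs y) := by
  simp [isNode, node]

end Realize

end BST

end SetTh

namespace SetTh

open FirstOrder FirstOrder.Language

/-! ### Assignments inside a model -/

section Assignments

variable {M : Type*} [LSet.Structure M]

local infix:50 " ε " => Mem

theorem exists_mem_iff_eq_pr [M ⊨ BST] (x y : M) :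
    ∃ z : M, ∀ p, p ε z ↔ ∃ a, a ε x ∧ ∃ b, b ε y ∧ p = pr a b := by
  have := realize_of_mem_BST (M := M) (σ := cartesianProduct) (by simp)
  simp only [cartesianProduct, isProd, Sentence.Realize, Formula.Realize, realize_fall,
    realize_fex, BoundedFormula.realize_inf, realize_ball, realize_bex, realize_isOPair,
    Fin.snoc_last, Fin.snoc_castSucc] at this
  obtain ⟨z, h₁, h₂⟩ := this x y
  refine ⟨z, fun p => ⟨h₁ p, ?_⟩⟩
  rintro ⟨a, ha, b, hb, rfl⟩
  obtain ⟨_, hp, rfl⟩ := h₂ a ha b hb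
  exact hp

/-- `s` is, in the model, a function from `k` to `y`. -/
def IsFun [M ⊨ BST] (s k y : M) : Prop :=
  (∀ p, p ε s → ∃ i, i ε k ∧ ∃ a, a ε y ∧ p = pr i a) ∧
    ∀ i, i ε k → ∃ a, a ε y ∧ pr i a ε s ∧ ∀ b, b ε y → pr i b ε s → b = a

theorem realize_isFunction [M ⊨ BST] {n : ℕ} {v : Empty → M} {xs : Fin n → M} {s x y : Fin n} :
    (isFunction s x y).Realize v xs ↔ IsFun (xs s) (xs x) (xs y) := by
  simp only [isFunction, IsFun, BoundedFormula.realize_inf, realize_ball, realize_bex,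
    BoundedFormula.realize_imp, realize_isOPair, realize_app, realize_feq, Fin.snoc_last,
    Fin.snoc_castSucc]

variable [M ⊨ BST]

theorem IsFun.eq {s k y i a b : M} (h : IsFun s k y) (ha : pr i a ε s) (hb : pr i b ε s) :
    a = b := by
  obtain ⟨i', hi, a', ha', e⟩ := h.1 _ ha
  obtain ⟨rfl, rfl⟩ := pr_inj.1 e
  obtain ⟨i', hi', b', hb', e⟩ := h.1 _ hb
  obtain ⟨rfl, rfl⟩ := pr_inj.1 e
  obtain ⟨c, -, -, hc⟩ := h.2 _ hi
  rw [hc _ ha' ha, hc _ hb' hb]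

theorem exists_isFun_const (k : M) {y a : M} (ha : a ε y) :
    ∃ s, IsFun s k y ∧ ∀ i, i ε k → pr i a ε s := by
  obtain ⟨s, hs⟩ := exists_mem_iff_eq_pr k (upair a a)
  simp only [mem_upair, or_self, exists_eq_left] at hs
  refine ⟨s, ⟨fun p hp => ?_, fun i hi => ⟨a, ha, (hs _).2 ⟨i, hi, rfl⟩, fun b _ hb => ?_⟩⟩,
    fun i hi => (hs _).2 ⟨i, hi, rfl⟩⟩
  · obtain ⟨i, hi, rfl⟩ := (hs p).1 hp
    exact ⟨i, hi, a, ha, rfl⟩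
  · obtain ⟨j, -, h⟩ := (hs _).1 hb
    exact (pr_inj.1 h).2

theorem IsDelta0.not {n : ℕ} {φ : Fml n} (h : IsDelta0 φ) : IsDelta0 (∼φ) := .imp h .falsum

theorem IsDelta0.inf {n : ℕ} {φ ψ : Fml n} (h₁ : IsDelta0 φ) (h₂ : IsDelta0 ψ) :
    IsDelta0 (φ ⊓ ψ) := .not (.imp h₁ h₂.not)

theorem IsDelta0.sup {n : ℕ} {φ ψ : Fml n} (h₁ : IsDelta0 φ) (h₂ : IsDelta0 ψ) :
    IsDelta0 (φ ⊔ ψ) := .imp h₁.not h₂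

theorem isDelta0_isUPair {n : ℕ} (p x y : Fin n) : IsDelta0 (isUPair p x y) :=
  .inf (.mem _ _) (.inf (.mem _ _) (.ball _ (.sup (.equal _ _) (.equal _ _))))

theorem isDelta0_isOPair {n : ℕ} (p x y : Fin n) : IsDelta0 (isOPair p x y) :=
  .bex _ (.bex _ (.inf (isDelta0_isUPair _ _ _) (.inf (isDelta0_isUPair _ _ _)
    (isDelta0_isUPair _ _ _))))

/-- Changing an assignment at one place. As the index set may be infinite from outside, this needs
separation. -/
theorem IsFun.exists_update {s k y i a : M} (h : IsFun s k y) (hi : i ε k) (ha : a ε y) :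
    ∃ s', IsFun s' k y ∧ pr i a ε s' ∧ ∀ j, j ≠ i → ∀ b, pr j b ε s → pr j b ε s' := by
  obtain ⟨s₀, hs₀⟩ := exists_separation (n := 2)
    (ψ := ∼(bex 1 fun b => isOPair (2 : Fin 3).castSucc (0 : Fin 3).castSucc b))
    (.not (.bex _ (isDelta0_isOPair _ _ _))) ![i, y] s
  have hs₀' : ∀ p, p ε s₀ ↔ p ε s ∧ ¬ ∃ b, b ε y ∧ p = pr i b := fun p => by
    rw [hs₀]
    simp only [BoundedFormula.realize_not, realize_bex, realize_isOPair, Fin.snoc_last,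
      Fin.snoc_castSucc]
    rfl
  refine ⟨mUnion s₀ (upair (pr i a) (pr i a)), ⟨?_, ?_⟩, by simp, ?_⟩
  · intro p hp
    rcases mem_mUnion.1 hp with hp | hp
    · exact h.1 p ((hs₀' p).1 hp).1
    · exact ⟨i, hi, a, ha, by simpa using hp⟩
  · intro j hj
    simp only [mem_mUnion, hs₀', mem_upair, or_self, pr_inj]
    by_cases hji : j = i
    · subst hji
      refine ⟨a, ha, .inr ⟨rfl, rfl⟩, fun b hb h => ?_⟩
      rcases h with h | h
      · exact (h.2 ⟨b, hb, rfl, rfl⟩).elim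
      · exact h.2
    · obtain ⟨b, hb, hb', hu⟩ := h.2 j hj
      refine ⟨b, hb, .inl ⟨hb', by simp [hji]⟩, fun c hc h => ?_⟩
      rcases h with h | h
      · exact hu c hc h.1
      · exact (hji h.1).elim
  · intro j hj b hb
    simp [hs₀', hb, hj]

end Assignments

/-! ### Formulas with named variables and their codes -/

namespace Scheme

/-- Satisfaction of a scheme, given the satisfaction of the formula put for the metavariable. -/
def Eval {N : Type*} [LSet.Structure N] (h : (ℕ → N) → Prop) : Scheme → (ℕ → N) → Prop
  | hole, e => h e
  | eq i j, e => e i = e j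
  | mem i j, e => Mem (e i) (e j)
  | imp s t, e => Eval h s e → Eval h t e
  | all i s, e => ∀ a, Eval h s (Function.update e i a)
  | falsum, _ => False

/-- The variables of a scheme, free or bound. -/
def vars : Scheme → Finset ℕ
  | hole => ∅
  | eq i j => {i, j}
  | mem i j => {i, j}
  | imp s t => s.vars ∪ t.vars
  | all i s => insert i s.vars
  | falsum => ∅

section Eval

variable {N : Type*} [LSet.Structure N] {h : (ℕ → N) → Prop} {e : ℕ → N} {s t : Scheme}

@[simp] theorem eval_hole : Eval h hole e ↔ h e := Iff.rfl

@[simp] theorem eval_eq {i j : ℕ} : Eval h (.eq i j) e ↔ e i = e j := Iff.rfl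

@[simp] theorem eval_mem {i j : ℕ} : Eval h (.mem i j) e ↔ Mem (e i) (e j) := Iff.rfl

@[simp] theorem eval_imp : Eval h (.imp s t) e ↔ (Eval h s e → Eval h t e) := Iff.rfl

@[simp] theorem eval_all {i : ℕ} : Eval h (.all i s) e ↔ ∀ a, Eval h s (Function.update e i a) :=
  Iff.rfl


@[simp] theorem eval_not : Eval h s.not e ↔ ¬ Eval h s e := Iff.rfl

@[simp] theorem eval_and : Eval h (s.and t) e ↔ Eval h s e ∧ Eval h t e := by
  simp [Scheme.and]

@[simp] theorem eval_iff : Eval h (s.iff t) e ↔ (Eval h s e ↔ Eval h t e) := by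
  simp [Scheme.iff, iff_iff_implies_and_implies]

@[simp] theorem eval_ex {i : ℕ} : Eval h (.ex i s) e ↔ ∃ a, Eval h s (Function.update e i a) := by
  simp [Scheme.ex]

end Eval

end Scheme

/-- The variable that a term of the language of set theory consists of. -/
def varIndex {n : ℕ} : LSet.Term (Empty ⊕ Fin n) → Fin n
  | .var (.inl e) => e.elim
  | .var (.inr i) => i
  | .func f _ => Empty.elim f

/-- A formula as a scheme without metavariable in which the free variable `i` is named `f i` and
the variable bound where `n` variables are in scope is named `off + n`. -/
def named (off : ℕ) : ∀ {n : ℕ}, Fml n → (Fin n → ℕ) → Scheme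
  | _, .falsum, _ => .falsum
  | _, .equal t s, f => .eq (f (varIndex t)) (f (varIndex s))
  | _, .rel MemRel.mem ts, f => .mem (f (varIndex (ts 0))) (f (varIndex (ts 1)))
  | _, .imp φ ψ, f => .imp (named off φ f) (named off ψ f)
  | n, .all φ, f => .all (off + n) (named off φ (Fin.snoc (α := fun _ => ℕ) f (off + n)))

theorem varNumber_eq {n : ℕ} (t : LSet.Term (Empty ⊕ Fin n)) : varNumber t = varIndex t := by
  rcases t with (a | a) | f
  exacts [a.elim, rfl, Empty.elim f]

theorem realize_eq_varIndex {N : Type*} [LSet.Structure N] {n : ℕ}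
    (t : LSet.Term (Empty ⊕ Fin n)) (v : Empty → N) (xs : Fin n → N) :
    t.realize (Sum.elim v xs) = xs (varIndex t) := by
  rcases t with (a | a) | f
  exacts [a.elim, rfl, Empty.elim f]

theorem toScheme_eq_named {n : ℕ} (φ : Fml n) : toScheme φ = named 0 φ Fin.val := by
  induction φ with
  | falsum => rfl
  | equal t s => simp [toScheme, named, varNumber_eq]
  | rel R ts => cases R; simp [toScheme, named, varNumber_eq]
  | imp _ _ ih₁ ih₂ => simp [toScheme, named, ih₁, ih₂]
  | @all n φ ih =>
    rw [toScheme, named, ih, zero_add]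
    congr 2
    funext i
    induction i using Fin.lastCases <;> simp

theorem eval_named {N : Type*} [LSet.Structure N] (h : (ℕ → N) → Prop) {off n : ℕ} (φ : Fml n)
    (f : Fin n → ℕ) (hf : ∀ i, f i < off + n) (e : ℕ → N) :
    (named off φ f).Eval h e ↔ φ.Realize default (e ∘ f) := by
  induction φ generalizing e with
  | falsum => exact Iff.rfl
  | equal t s =>
    rw [named, Scheme.eval_eq, BoundedFormula.Realize, realize_eq_varIndex, realize_eq_varIndex]
    rfl
  | rel R ts =>
    cases R
    rw [named, Scheme.eval_mem, Mem]
    refine iff_of_eq (congrArg (Structure.RelMap (L := LSet) (MemRel.mem : LSet.Relations 2))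
      (funext fun i => ?_))
    rw [realize_eq_varIndex]
    fin_cases i <;> rfl
  | imp _ _ ih₁ ih₂ => rw [named, Scheme.eval_imp, ih₁ f hf, ih₂ f hf, BoundedFormula.realize_imp]
  | @all n φ ih =>
    rw [named, Scheme.eval_all, BoundedFormula.realize_all]
    refine forall_congr' fun a => ?_
    rw [ih _ fun i => ?_]
    · refine iff_of_eq (congrArg _ (funext fun i => ?_))
      induction i using Fin.lastCases with
      | last => simp
      | cast i => simp [(hf i).ne]
    · induction i using Fin.lastCases with
      | last => simp
      | cast i => simpa using (hf i).trans (by simp)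

theorem mem_vars_named {off n : ℕ} (φ : Fml n) (f : Fin n → ℕ) {i : ℕ}
    (hi : i ∈ (named off φ f).vars) : (∃ j, f j = i) ∨ off ≤ i := by
  induction φ with
  | falsum => simp [named, Scheme.vars] at hi
  | equal t s =>
    simp only [named, Scheme.vars, Finset.mem_insert, Finset.mem_singleton] at hi
    rcases hi with rfl | rfl <;> exact .inl ⟨_, rfl⟩
  | rel R ts =>
    cases R
    simp only [named, Scheme.vars, Finset.mem_insert, Finset.mem_singleton] at hi
    rcases hi with rfl | rfl <;> exact .inl ⟨_, rfl⟩
  | imp _ _ ih₁ ih₂ =>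
    simp only [named, Scheme.vars, Finset.mem_union] at hi
    exact hi.elim (ih₁ f) (ih₂ f)
  | @all n φ ih =>
    simp only [named, Scheme.vars, Finset.mem_insert] at hi
    rcases hi with rfl | hi
    · exact .inr (Nat.le_add_right _ _)
    · rcases ih _ hi with ⟨j, rfl⟩ | h
      · induction j using Fin.lastCases with
        | last => simp
        | cast j => exact .inl ⟨j, by simp⟩
      · exact .inr h

section Codes

variable {M : Type*} [LSet.Structure M] [M ⊨ BST]

local infix:50 " ε " => Mem

variable (M) in
/-- The code of falsity. -/
noncomputable def codeFalsum : M := node 4 (mEmpty M) (mEmpty M)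

/-- The code, in a model, of the formula obtained by putting the formula `h` for the
metavariable. -/
noncomputable def code (h : M) : Scheme → M
  | .hole => h
  | .eq i j => node 0 (num M i) (num M j)
  | .mem i j => node 1 (num M i) (num M j)
  | .imp s t => node 2 (code h s) (code h t)
  | .all i s => node 3 (num M i) (code h s)
  | .falsum => codeFalsum M

@[simp]
theorem realize_isInstance {n : ℕ} {v : Empty → M} {xs : Fin n → M} (s : Scheme) {h c : Fin n} :
    (isInstance s h c).Realize v xs ↔ xs c = code (xs h) s := by
  induction s generalizing n <;>
    simp only [isInstance, code, codeFalsum, realize_feq, realize_fex, BoundedFormula.realize_inf,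
      realize_isNum, realize_isNode, realize_isEmpty, Fin.snoc_last, Fin.snoc_castSucc,
      exists_eq_left, *]
  case imp => aesop
  case eq => aesop
  case mem => aesop
  case all => aesop

/-- A formula has no metavariable, hence its code does not depend on what is put for it. -/
theorem code_named (h h' : M) {off n : ℕ} (φ : Fml n) (f : Fin n → ℕ) :
    code h (named off φ f) = code h' (named off φ f) := by
  induction φ with
  | falsum => rfl
  | equal => rfl
  | rel R _ => cases R; rfl
  | imp _ _ ih₁ ih₂ => simp only [named, code, ih₁ f, ih₂ f]
  | all _ ih => simp only [named, code, ih]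

variable (M) in
/-- `r` is a natural number of the model, possibly a nonstandard one. -/
def IsNatural (r : M) : Prop := (isNat (0 : Fin 1)).Realize default fun _ => r

omit [M ⊨ BST] in
theorem realize_isNat {n : ℕ} {v : Empty → M} {xs : Fin n → M} {x : Fin n} :
    (isNat x).Realize v xs ↔ IsNatural M (xs x) := by
  simp only [IsNatural, isNat, isOrdinal, isSucc, isEmpty, BoundedFormula.realize_inf,
    BoundedFormula.realize_sup, realize_isTransitive, realize_ball, realize_bex, realize_fall,
    BoundedFormula.realize_not, realize_fmem, realize_feq, realize_subset, Fin.snoc_last,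
    Fin.snoc_castSucc]

theorem isNatural_num (k : ℕ) : IsNatural M (num M k) := realize_isNat_of_eq_num rfl

/-- `c` is atomic with variables in `d`, or falsity, or formed from codes with the property `P`. -/
def IsStep (d c : M) (P : M → Prop) : Prop :=
  (∃ i, i ε d ∧ ∃ j, j ε d ∧ (c = node 0 i j ∨ c = node 1 i j)) ∨
    (∃ x y, c = node 2 x y ∧ P x ∧ P y) ∨
    (∃ i, i ε d ∧ ∃ x, c = node 3 i x ∧ P x) ∨ c = codeFalsum M

theorem IsStep.mono {d c : M} {P Q : M → Prop} (h : IsStep d c P) (hPQ : ∀ x, P x → Q x) :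
    IsStep d c Q := by
  rcases h with h | ⟨x, y, e, hx, hy⟩ | ⟨i, hi, x, e, hx⟩ | h
  · exact .inl h
  · exact .inr (.inl ⟨x, y, e, hPQ x hx, hPQ y hy⟩)
  · exact .inr (.inr (.inl ⟨i, hi, x, e, hPQ x hx⟩))
  · exact .inr (.inr (.inr h))

/-- `w` is, in the model, a construction of formulas with variables in `d`. -/
def IsConstr (d w : M) : Prop :=
  ∀ p, p ε w → ∃ r c, p = pr r c ∧ IsNatural M r ∧ IsStep d c fun x => ∃ q, q ε r ∧ pr q x ε w

theorem realize_isConstruction {n : ℕ} {v : Empty → M} {xs : Fin n → M} {d w : Fin n} :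
    (isConstruction d w).Realize v xs ↔ IsConstr (xs d) (xs w) := by
  simp only [isConstruction, IsConstr, IsStep, occursBefore, codeFalsum, realize_ball, realize_bex,
    realize_fex, BoundedFormula.realize_inf, BoundedFormula.realize_sup, realize_isOPair,
    realize_isNat, realize_isNode, realize_isEmpty, realize_app, Fin.snoc_last, Fin.snoc_castSucc,
    exists_eq_left]

theorem realize_occurs {n : ℕ} {v : Empty → M} {xs : Fin n → M} {w c : Fin n} :
    (occurs w c).Realize v xs ↔ ∃ r, pr r (xs c) ε xs w := by
  simp [occurs]

theorem IsConstr.union {d w₁ w₂ : M} (h₁ : IsConstr d w₁) (h₂ : IsConstr d w₂) :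
    IsConstr d (mUnion w₁ w₂) := by
  intro p hp
  rcases mem_mUnion.1 hp with hp | hp
  · obtain ⟨r, c, e, hr, h⟩ := h₁ p hp
    exact ⟨r, c, e, hr, h.mono fun x ⟨q, hq, hx⟩ => ⟨q, hq, mem_mUnion.2 (.inl hx)⟩⟩
  · obtain ⟨r, c, e, hr, h⟩ := h₂ p hp
    exact ⟨r, c, e, hr, h.mono fun x ⟨q, hq, hx⟩ => ⟨q, hq, mem_mUnion.2 (.inr hx)⟩⟩

theorem IsConstr.insert {d w : M} (h : IsConstr d w) {k : ℕ} {c : M}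
    (hc : IsStep d c fun x => ∃ q < k, pr (num M q) x ε w) :
    ∃ w', IsConstr d w' ∧ pr (num M k) c ε w' := by
  refine ⟨mUnion w (upair (pr (num M k) c) (pr (num M k) c)), fun p hp => ?_, by simp⟩
  rcases mem_mUnion.1 hp with hp | hp
  · obtain ⟨r, c, e, hr, h⟩ := h p hp
    exact ⟨r, c, e, hr, h.mono fun x ⟨q, hq, hx⟩ => ⟨q, hq, mem_mUnion.2 (.inl hx)⟩⟩
  · exact ⟨num M k, c, by simpa using hp, isNatural_num k,
      hc.mono fun x ⟨q, hq, hx⟩ => ⟨_, num_mem_num hq, mem_mUnion.2 (.inl hx)⟩⟩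

/-- The codes of standard formulas have constructions in the model. -/
theorem exists_isConstr {d : M} (s : Scheme) (hs : ∀ i ∈ s.vars, num M i ε d) :
    ∃ w, IsConstr d w ∧ ∃ k, pr (num M k) (code (codeFalsum M) s) ε w := by
  have empty : IsConstr d (mEmpty M) := fun p hp => (not_mem_mEmpty hp).elim
  induction s with
  | hole =>
    obtain ⟨w, hw, h⟩ := empty.insert (k := 0) (.inr (.inr (.inr rfl)))
    exact ⟨w, hw, 0, h⟩
  | eq i j =>
    obtain ⟨w, hw, h⟩ := empty.insert (k := 0) (.inl ⟨_, hs i (by simp [Scheme.vars]), _,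
      hs j (by simp [Scheme.vars]), .inl rfl⟩)
    exact ⟨w, hw, 0, h⟩
  | mem i j =>
    obtain ⟨w, hw, h⟩ := empty.insert (k := 0) (.inl ⟨_, hs i (by simp [Scheme.vars]), _,
      hs j (by simp [Scheme.vars]), .inr rfl⟩)
    exact ⟨w, hw, 0, h⟩
  | imp s t ihs iht =>
    obtain ⟨w₁, hw₁, k₁, h₁⟩ := ihs fun i hi => hs i (by simp [Scheme.vars, hi])
    obtain ⟨w₂, hw₂, k₂, h₂⟩ := iht fun i hi => hs i (by simp [Scheme.vars, hi])
    obtain ⟨w, hw, h⟩ := (hw₁.union hw₂).insert (k := max k₁ k₂ + 1) (.inr (.inl ⟨_, _, rfl,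
      ⟨k₁, by omega, mem_mUnion.2 (.inl h₁)⟩, k₂, by omega, mem_mUnion.2 (.inr h₂)⟩))
    exact ⟨w, hw, _, h⟩
  | all i s ih =>
    obtain ⟨w₁, hw₁, k₁, h₁⟩ := ih fun i hi => hs i (by simp [Scheme.vars, hi])
    obtain ⟨w, hw, h⟩ := hw₁.insert (k := k₁ + 1) (.inr (.inr (.inl ⟨_,
      hs i (by simp [Scheme.vars]), _, rfl, k₁, by omega, h₁⟩)))
    exact ⟨w, hw, _, h⟩
  | falsum =>
    obtain ⟨w, hw, h⟩ := empty.insert (k := 0) (.inr (.inr (.inr rfl)))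
    exact ⟨w, hw, 0, h⟩

end Codes

end SetTh

namespace SetTh

open FirstOrder FirstOrder.Language

/-! ### Satisfaction inside a model and outside -/

section Satisfaction

variable {M : Type*} [LSet.Structure M]

local infix:50 " ε " => Mem

/-- The elements of the set `y` of a model, as a structure with the membership of the model. -/
abbrev Elements (y : M) : Type _ := {a : M // a ε y}

instance (y : M) : LSet.Structure (Elements y) where
  funMap f := isEmptyElim f
  RelMap R xs := Structure.RelMap R fun i => (xs i).1

theorem mem_elements_iff {y : M} {a b : Elements y} : a ε b ↔ a.1 ε b.1 := by
  have : (fun i => (![a, b] i).1) = ![a.1, b.1] := by funext i; fin_cases i <;> rfl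
  rw [Mem, Mem, ← this]
  rfl

variable [M ⊨ BST]

/-- `t` obeys Tarski's clauses in the model. -/
def IsSat (y k w m t : M) : Prop :=
  ∀ c, (∃ r, pr r c ε w) → ∀ s, s ε m →
    (∀ i, i ε k → ∀ j, j ε k → c = node 0 i j →
      (pr c s ε t ↔ ∃ a, a ε y ∧ pr i a ε s ∧ pr j a ε s)) ∧
    (∀ i, i ε k → ∀ j, j ε k → c = node 1 i j →
      (pr c s ε t ↔ ∃ a, a ε y ∧ ∃ b, b ε y ∧ pr i a ε s ∧ pr j b ε s ∧ a ε b)) ∧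
    (∀ x z, c = node 2 x z → (pr c s ε t ↔ (pr x s ε t → pr z s ε t))) ∧
    (∀ i, i ε k → ∀ x, c = node 3 i x → (pr c s ε t ↔ ∀ s', s' ε m →
      (∀ j, j ε k → j ≠ i → ∃ a, a ε y ∧ pr j a ε s ∧ pr j a ε s') → pr x s' ε t)) ∧
    (c = codeFalsum M → ¬ pr c s ε t)

theorem realize_isSatisfaction {n : ℕ} {v : Empty → M} {xs : Fin n → M} {y k w m t : Fin n} :
    (isSatisfaction y k w m t).Realize v xs ↔ IsSat (xs y) (xs k) (xs w) (xs m) (xs t) := by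
  simp only [isSatisfaction, IsSat, agreeOff, codeFalsum, realize_fall, realize_ball, realize_bex,
    BoundedFormula.realize_inf, BoundedFormula.realize_imp, BoundedFormula.realize_iff,
    BoundedFormula.realize_not, realize_occurs, realize_isNode, realize_isEmpty, realize_app,
    realize_feq, realize_fmem, Fin.snoc_last, Fin.snoc_castSucc, and_imp, forall_eq, ne_eq]

/-- `(y, ∈) ⊨ c` in the model. -/
def Models (y c : M) : Prop :=
  ∃ k, IsNatural M k ∧ ∃ w, IsConstr k w ∧ (∃ r, pr r c ε w) ∧
    ∃ m, (∀ s, s ε m ↔ IsFun s k y) ∧ ∃ t, IsSat y k w m t ∧ ∀ s, s ε m → pr c s ε t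

theorem realize_models {n : ℕ} {v : Empty → M} {xs : Fin n → M} {y c : Fin n} :
    (models y c).Realize v xs ↔ Models (xs y) (xs c) := by
  simp only [models, Models, realize_fall, realize_fex, realize_ball, BoundedFormula.realize_inf,
    BoundedFormula.realize_iff, realize_isNat, realize_isConstruction, realize_occurs,
    realize_isFunction, realize_isSatisfaction, realize_app, realize_fmem, Fin.snoc_last,
    Fin.snoc_castSucc]

/-- The set `s` of the model extends, as a function on numbers, the external assignment `e`
wherever its index set `k` allows. -/
def Extends {y : M} (k s : M) (e : ℕ → Elements y) : Prop :=
  ∀ i, num M i ε k → pr (num M i) (e i).1 ε s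

theorem Extends.update {y k s s' : M} {e : ℕ → Elements y} (hs : Extends k s e) {i : ℕ}
    (a : Elements y) (ha : pr (num M i) a.1 ε s')
    (h : ∀ j, j ε k → j ≠ num M i → ∀ b, pr j b ε s → pr j b ε s') :
    Extends k s' (Function.update e i a) := by
  intro j hj
  by_cases hji : j = i
  · subst hji
    simpa using ha
  · rw [Function.update_of_ne hji]
    exact h _ hj (by simpa using hji) _ (hs j hj)

/-- Every external assignment that is eventually constant is extended by one of the model, even if
the index set is infinite from outside. -/
theorem exists_isFun_extends {y : M} (k : M) (e : ℕ → Elements y) (a : Elements y) (B : ℕ) :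
    ∃ s, IsFun s k y ∧ Extends k s fun i => if i < B then e i else a := by
  induction B with
  | zero =>
    obtain ⟨s, hs, h⟩ := exists_isFun_const k a.2
    exact ⟨s, hs, fun i hi => by simpa using h _ hi⟩
  | succ B ih =>
    obtain ⟨s, hs, h⟩ := ih
    have e_eq : (fun i => if i < B + 1 then e i else a) =
        Function.update (fun i => if i < B then e i else a) B (e B) := by
      funext i
      rcases lt_trichotomy i B with hi | rfl | hi
      · simp [hi, hi.ne, hi.trans B.lt_succ_self]
      · simp
      · simp [hi.ne', hi.not_gt, Nat.not_lt.2 (Nat.succ_le_of_lt hi)]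
    rw [e_eq]
    by_cases hB : num M B ε k
    · obtain ⟨s', hs', h₁, h₂⟩ := hs.exists_update hB (e B).2
      exact ⟨s', hs', h.update _ h₁ fun j _ hj b => h₂ j hj b⟩
    · refine ⟨s, hs, fun i hi => ?_⟩
      rw [Function.update_of_ne (by rintro rfl; exact hB hi)]
      exact h i hi

section Truth

variable {y k w m t : M} (hw : IsConstr k w) (hm : ∀ s, s ε m ↔ IsFun s k y)
  (ht : IsSat y k w m t)

include hw hm ht

/-- On codes of standard formulas, a satisfaction relation of the model agrees with actual
satisfaction in the structure of the elements of `y`. -/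
theorem mem_satisfaction_iff_eval {h : M} {P : (ℕ → Elements y) → Prop}
    (hP : (∃ r, pr r h ε w) → ∀ s, s ε m → ∀ e : ℕ → Elements y, Extends k s e →
      (pr h s ε t ↔ P e))
    (S : Scheme) (hS : ∃ r, pr r (code h S) ε w) {s : M} (hs : s ε m) {e : ℕ → Elements y}
    (he : Extends k s e) : pr (code h S) s ε t ↔ S.Eval P e := by
  have step : ∀ {S}, (∃ r, pr r (code h S) ε w) →
      IsStep k (code h S) fun x => ∃ r, pr r x ε w := by
    rintro S ⟨r, hr⟩
    obtain ⟨r', c, e, -, hc⟩ := hw _ hr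
    obtain ⟨rfl, rfl⟩ := pr_inj.1 e
    exact hc.mono fun x ⟨q, _, hx⟩ => ⟨q, hx⟩
  induction S generalizing s e with
  | hole => exact hP hS s hs e he
  | eq i j =>
    have hij : num M i ε k ∧ num M j ε k := by simpa [IsStep, code, codeFalsum] using step hS
    rw [(ht _ hS s hs).1 _ hij.1 _ hij.2 rfl, Scheme.eval_eq]
    constructor
    · rintro ⟨a, -, h₁, h₂⟩
      have hf := (hm s).1 hs
      exact Subtype.ext ((hf.eq (he i hij.1) h₁).trans (hf.eq h₂ (he j hij.2)))
    · intro h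
      exact ⟨(e i).1, (e i).2, he i hij.1, h ▸ he j hij.2⟩
  | mem i j =>
    have hij : num M i ε k ∧ num M j ε k := by simpa [IsStep, code, codeFalsum] using step hS
    rw [(ht _ hS s hs).2.1 _ hij.1 _ hij.2 rfl, Scheme.eval_mem, mem_elements_iff]
    constructor
    · rintro ⟨a, -, b, -, h₁, h₂, hab⟩
      have hf := (hm s).1 hs
      rwa [hf.eq (he i hij.1) h₁, hf.eq (he j hij.2) h₂]
    · intro h
      exact ⟨_, (e i).2, _, (e j).2, he i hij.1, he j hij.2, h⟩
  | imp S₁ S₂ ih₁ ih₂ =>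
    have hSS : (∃ r, pr r (code h S₁) ε w) ∧ ∃ r, pr r (code h S₂) ε w := by
      simpa [IsStep, code, codeFalsum, and_assoc] using step hS
    exact ((ht _ hS s hs).2.2.1 _ _ rfl).trans
      (imp_congr (ih₁ hSS.1 hs he) (ih₂ hSS.2 hs he))
  | all i S ih =>
    have hiS : num M i ε k ∧ ∃ r, pr r (code h S) ε w := by
      simpa [IsStep, code, codeFalsum, and_assoc] using step hS
    have hf := (hm s).1 hs
    rw [(ht _ hS s hs).2.2.2.1 _ hiS.1 _ rfl, Scheme.eval_all]
    constructor
    · intro h a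
      obtain ⟨s', hs', h₁, h₂⟩ := hf.exists_update hiS.1 a.2
      refine (ih hiS.2 ((hm s').2 hs') (he.update a h₁ fun j _ hj b => h₂ j hj b)).1
        (h s' ((hm s').2 hs') fun j hj hji => ?_)
      obtain ⟨b, hb, hb', -⟩ := hf.2 j hj
      exact ⟨b, hb, hb', h₂ j hji b hb'⟩
    · intro h s' hs' h_agree
      obtain ⟨a, ha, ha', -⟩ := ((hm s').1 hs').2 _ hiS.1
      refine (ih hiS.2 hs' (he.update ⟨a, ha⟩ ha' fun j hj hji b hb => ?_)).2 (h _)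
      obtain ⟨b', -, h₁, h₂⟩ := h_agree j hj hji
      rwa [hf.eq hb h₁]
  | falsum => exact iff_of_false ((ht _ hS s hs).2.2.2.2 rfl) id

end Truth

/-- If `y` satisfies, in the model, the formula obtained from the scheme `S` by putting the code of
the standard formula `H`, then the structure of its elements satisfies it under all eventually
constant assignments. -/
theorem Models.eval {y : M} {S H : Scheme}
    (h : Models y (code (code (codeFalsum M) H) S)) (e : ℕ → Elements y) (a : Elements y) (B : ℕ) :
    S.Eval (H.Eval fun _ => False) fun i => if i < B then e i else a := by
  obtain ⟨k, -, w, hw, hc, m, hm, t, ht, hsat⟩ := h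
  obtain ⟨s, hs, he⟩ := exists_isFun_extends k e a B
  have hs' := (hm s).2 hs
  refine (mem_satisfaction_iff_eval hw hm ht (fun hH s hs e he => ?_) S hc hs' he).1 (hsat s hs')
  exact mem_satisfaction_iff_eval hw hm ht
    (fun h₀ s hs e _ => iff_of_false ((ht _ h₀ s hs).2.2.2.2 rfl) id) H hH hs he

/-- `Models.eval` for an assignment with prescribed values at `v₅, …, v_{5 + n - 1}`, the variables
used for the parameters of the axiom schemes. -/
theorem Models.exists_params {y : M} [Nonempty (Elements y)] {S H : Scheme} {n : ℕ}
    (z : Fin n → Elements y) (h : Models y (code (code (codeFalsum M) H) S)) :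
    ∃ e : ℕ → Elements y, (∀ i : Fin n, e (5 + i) = z i) ∧ S.Eval (H.Eval fun _ => False) e := by
  obtain ⟨a⟩ := ‹Nonempty (Elements y)›
  exact ⟨_, fun i => by simp, h.eval (fun i => if hi : i - 5 < n then z ⟨i - 5, hi⟩ else a) a
    (5 + n)⟩

/-- `c` is, in the model, an axiom of ZFC. -/
def IsAxiom (c : M) : Prop :=
  (∃ σ ∈ singleAxioms, c = code c (toScheme (n := 0) σ)) ∨
    (∃ d h, (∀ i, i ε d → IsNatural M i ∧ i ≠ num M 3) ∧
      (∃ w, IsConstr d w ∧ ∃ r, pr r h ε w) ∧ c = code h separationScheme) ∨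
    ∃ d h, (∀ i, i ε d → IsNatural M i ∧ i ≠ num M 3 ∧ i ≠ num M 4) ∧
      (∃ w, IsConstr d w ∧ ∃ r, pr r h ε w) ∧ c = code h replacementScheme

theorem realize_isZFCAxiom {n : ℕ} {v : Empty → M} {xs : Fin n → M} {c : Fin n} :
    (isZFCAxiom c).Realize v xs ↔ IsAxiom (xs c) := by
  have fold : ∀ l : List LSet.Sentence,
      (l.foldr (fun σ φ => f_or (isInstance (toScheme (n := 0) σ) c c) φ) ⊥).Realize v xs ↔
        ∃ σ ∈ l, xs c = code (xs c) (toScheme (n := 0) σ) := fun l => by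
    induction l with
    | nil => simp
    | cons σ l ih => simp [ih]
  simp only [isZFCAxiom, IsAxiom, isFormulaOver, realize_fex, realize_ball,
    BoundedFormula.realize_inf, BoundedFormula.realize_sup, BoundedFormula.realize_not, fold,
    realize_isNat, realize_isNum, realize_isConstruction, realize_occurs, realize_isInstance,
    Fin.snoc_last, Fin.snoc_castSucc, ne_eq]

theorem realize_modelsZFC {n : ℕ} {v : Empty → M} {xs : Fin n → M} {y : Fin n} :
    (modelsZFC y).Realize v xs ↔ ∀ c, IsAxiom c → Models (xs y) c := by
  simp only [modelsZFC, realize_fall, BoundedFormula.realize_imp, realize_isZFCAxiom,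
    realize_models, Fin.snoc_last, Fin.snoc_castSucc]

/-- A standard formula has a code in the model, as a formula in its variables. -/
theorem exists_isFormulaOver (H : Scheme) : ∃ d : M, (∀ i, i ε d → ∃ j ∈ H.vars, i = num M j) ∧
    ∃ w, IsConstr d w ∧ ∃ r, pr r (code (codeFalsum M) H) ε w := by
  obtain ⟨d, hd⟩ := exists_mem_iff_mem_list (H.vars.toList.map (num M))
  obtain ⟨w, hw, k, hk⟩ := exists_isConstr (d := d) H fun i hi =>
    (hd _).2 (List.mem_map_of_mem (Finset.mem_toList.2 hi))
  refine ⟨d, fun i hi => ?_, w, hw, _, hk⟩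
  obtain ⟨j, hj, rfl⟩ := List.mem_map.1 ((hd _).1 hi)
  exact ⟨j, Finset.mem_toList.1 hj, rfl⟩

/-- A set that the model believes to satisfy ZFC satisfies every actual axiom of ZFC, as these
have codes in the model. -/
theorem elements_models_ZFC {y₀ : M} [Nonempty (Elements y₀)] (h : ∀ c, IsAxiom c → Models y₀ c) :
    Elements y₀ ⊨ ZFC := by
  obtain ⟨a₀⟩ := ‹Nonempty (Elements y₀)›
  refine ⟨fun σ hσ => ?_⟩
  rcases hσ with hσ | ⟨n, ψ, rfl⟩ | ⟨n, ψ, rfl⟩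
  · have hc := h (code (code (codeFalsum M) .falsum) (toScheme (n := 0) σ)) (.inl ⟨σ, hσ, by
      rw [toScheme_eq_named]; exact code_named _ _ _ _⟩)
    have := hc.eval (fun _ => a₀) a₀ 0
    rw [toScheme_eq_named, eval_named _ _ _ fun i => i.elim0] at this
    exact (realize_sentence_iff _ _).1 this
  · rw [realize_separation]
    intro z a
    -- The named formula has `v₁` for the element, `v₅, v₆, …` for the parameters, and leaves out
    -- the variables that the scheme binds.
    let f : Fin (n + 1) → ℕ := Fin.snoc (α := fun _ => ℕ) (fun i => 5 + i) 1
    have hf : ∀ i, f i < 5 + (n + 1) := fun i => by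
      induction i using Fin.lastCases with
      | last => simp only [f, Fin.snoc_last]; omega
      | cast i => simp only [f, Fin.snoc_castSucc]; omega
    obtain ⟨d, hd, hw⟩ := exists_isFormulaOver (M := M) (named 5 ψ f)
    have hc := h _ (.inr (.inl ⟨d, _, fun i hi => ?_, hw, rfl⟩))
    · obtain ⟨e, he, this⟩ := hc.exists_params z
      have key : ∀ b x, Function.update (Function.update (Function.update e 2 a) 3 b) 1 x ∘ f =
          Fin.snoc z x := fun b x => by
        funext i
        induction i using Fin.lastCases with
        | last => simp [f]
        | cast i =>
          simp only [f, Function.comp, Fin.snoc_castSucc]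
          rw [Function.update_of_ne (by omega), Function.update_of_ne (by omega),
            Function.update_of_ne (by omega), he]
      simp only [separationScheme, Scheme.eval_all, Scheme.eval_ex, Scheme.eval_iff,
        Scheme.eval_mem, Scheme.eval_and, Scheme.eval_hole, eval_named _ ψ f hf] at this
      obtain ⟨b, hb⟩ := this a
      refine ⟨b, fun x => ?_⟩
      simpa [key] using hb x
    · obtain ⟨j, hj, rfl⟩ := hd i hi
      refine ⟨isNatural_num j, fun h => ?_⟩
      obtain rfl := num_inj.1 h
      rcases mem_vars_named ψ f hj with ⟨i, hi⟩ | h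
      · induction i using Fin.lastCases with
        | last => simp [f] at hi
        | cast i => simp only [f, Fin.snoc_castSucc] at hi; omega
      · omega
  · rw [realize_replacement]
    intro z a
    -- As for separation, with `v₀` for the argument and `v₁` for the value.
    let f : Fin (n + 2) → ℕ := Fin.snoc (α := fun _ => ℕ)
      (Fin.snoc (α := fun _ => ℕ) (fun i : Fin n => 5 + i) 0) 1
    have hf : ∀ i, f i < 5 + (n + 2) := fun i => by
      induction i using Fin.lastCases with
      | last => simp only [f, Fin.snoc_last]; omega
      | cast i =>
        induction i using Fin.lastCases with
        | last => simp [f]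
        | cast i => simp only [f, Fin.snoc_castSucc]; omega
    obtain ⟨d, hd, hw⟩ := exists_isFormulaOver (M := M) (named 5 ψ f)
    have hc := h _ (.inr (.inr ⟨d, _, fun i hi => ?_, hw, rfl⟩))
    · obtain ⟨e, he, this⟩ := hc.exists_params z
      have key₁ : ∀ u x y, Function.update (Function.update (Function.update
          (Function.update e 2 a) 0 x) 4 u) 1 y ∘ f =
          (Fin.snoc (Fin.snoc z x : Fin (n + 1) → Elements y₀) y : Fin (n + 2) → Elements y₀) :=
          fun u x y => by
        funext i
        induction i using Fin.lastCases with
        | last => simp [f]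
        | cast i =>
          induction i using Fin.lastCases with
          | last => simp [f]
          | cast i =>
            simp only [f, Function.comp, Fin.snoc_castSucc]
            rw [Function.update_of_ne (by omega), Function.update_of_ne (by omega),
              Function.update_of_ne (by omega), Function.update_of_ne (by omega), he]
      have key₂ : ∀ b x y, Function.update (Function.update (Function.update
          (Function.update e 2 a) 3 b) 0 x) 1 y ∘ f =
          (Fin.snoc (Fin.snoc z x : Fin (n + 1) → Elements y₀) y : Fin (n + 2) → Elements y₀) :=
          fun u x y => by
        funext i
        induction i using Fin.lastCases with
        | last => simp [f]
        | cast i =>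
          induction i using Fin.lastCases with
          | last => simp [f]
          | cast i =>
            simp only [f, Function.comp, Fin.snoc_castSucc]
            rw [Function.update_of_ne (by omega), Function.update_of_ne (by omega),
              Function.update_of_ne (by omega), Function.update_of_ne (by omega), he]
      simp only [replacementScheme, Scheme.eval_all, Scheme.eval_ex, Scheme.eval_iff,
        Scheme.eval_mem, Scheme.eval_and, Scheme.eval_hole, Scheme.eval_imp, Scheme.eval_eq,
        eval_named _ ψ f hf] at this
      simpa [key₁, key₂] using this a
    · obtain ⟨j, hj, rfl⟩ := hd i hi
      suffices ∀ l, l = 3 ∨ l = 4 → j ≠ l from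
        ⟨isNatural_num j, fun h => this 3 (.inl rfl) (num_inj.1 h),
          fun h => this 4 (.inr rfl) (num_inj.1 h)⟩
      rintro l hl rfl
      rcases mem_vars_named ψ f hj with ⟨i, hi⟩ | h
      · induction i using Fin.lastCases with
        | last => simp [f] at hi; omega
        | cast i =>
          induction i using Fin.lastCases with
          | last => simp [f] at hi; omega
          | cast i => simp only [f, Fin.snoc_castSucc] at hi; omega
      · omega

end Satisfaction

end SetTh

namespace SetTh

open FirstOrder FirstOrder.Language

/-! ### Absoluteness and reflection -/

section Absoluteness

variable {M : Type*} [LSet.Structure M]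

local infix:50 " ε " => Mem

theorem IsDelta0.realize_elements_iff {y : M} (hy : ∀ z, z ε y → ∀ t, t ε z → t ε y) {n : ℕ}
    {φ : Fml n} (hφ : IsDelta0 φ) (xs : Fin n → Elements y) :
    φ.Realize default xs ↔ φ.Realize default fun i => (xs i).1 := by
  have snoc : ∀ {n : ℕ} (xs : Fin n → Elements y) (a : Elements y),
      (fun i => ((Fin.snoc xs a : Fin (n + 1) → Elements y) i).1) =
        (Fin.snoc (fun i => (xs i).1) a.1 : Fin (n + 1) → M) := fun xs a => by
    funext i
    induction i using Fin.lastCases <;> simp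
  induction hφ with
  | falsum => exact Iff.rfl
  | equal i j => simpa using Subtype.ext_iff
  | mem i j => simpa using mem_elements_iff
  | imp _ _ ih₁ ih₂ => exact imp_congr (ih₁ xs) (ih₂ xs)
  | ball i _ ih =>
    simp only [realize_ball, ih, snoc, mem_elements_iff]
    exact ⟨fun h a ha => h ⟨a, hy _ (xs i).2 a ha⟩ ha, fun h a => h a.1⟩
  | bex i _ ih =>
    simp only [realize_bex, ih, snoc, mem_elements_iff]
    exact ⟨fun ⟨a, h⟩ => ⟨a.1, h⟩, fun ⟨a, ha, h⟩ => ⟨⟨a, hy _ (xs i).2 a ha⟩, ha, h⟩⟩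

theorem IsSigma1.realize_of_elements {y : M} (hy : ∀ z, z ε y → ∀ t, t ε z → t ε y) {n : ℕ}
    {φ : Fml n} (hφ : IsSigma1 φ) (xs : Fin n → Elements y) (h : φ.Realize default xs) :
    φ.Realize default fun i => (xs i).1 := by
  induction hφ with
  | delta0 hφ => exact (hφ.realize_elements_iff hy xs).1 h
  | ex _ ih =>
    obtain ⟨a, ha⟩ := BoundedFormula.realize_ex.1 h
    refine BoundedFormula.realize_ex.2 ⟨a.1, ?_⟩
    convert ih _ ha using 1
    funext i
    induction i using Fin.lastCases <;> simp

/-- In a model of LZFC, finitely many elements belong to a transitive set which the model believes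
to satisfy ZFC: apply `Loc(ZFC)` to the set of these elements. -/
theorem exists_transitive_models_ZFC [M ⊨ BST] (hM : M ⊨ locZFC) {n : ℕ} (xs : Fin n → M) :
    ∃ y : M, Nonempty (Elements y) ∧ (∀ i, xs i ε y) ∧ (∀ z, z ε y → ∀ t, t ε z → t ε y) ∧
      ∀ c, IsAxiom c → Models y c := by
  obtain ⟨s, hs⟩ := exists_mem_iff_mem_list (List.ofFn xs)
  have := hM
  simp only [locZFC, Sentence.Realize, Formula.Realize, realize_fall, realize_fex,
    BoundedFormula.realize_inf, realize_fmem, realize_isTransitive, realize_modelsZFC,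
    Fin.snoc_last, Fin.snoc_castSucc] at this
  obtain ⟨y, hsy, hy, h⟩ := this s
  exact ⟨y, ⟨s, hsy⟩, fun i => hy s hsy _ ((hs _).2 (List.mem_ofFn.2 ⟨i, rfl⟩)), hy, h⟩

/-- A `Π₂` formula which holds in all transitive sets that satisfy ZFC holds in the universe: the
outer quantifiers choose finitely many elements, and a transitive set containing these provides
witnesses for the inner ones, as `Σ₁` formulas persist upwards. -/
theorem IsPi2.realize_of_forall_elements [M ⊨ BST] (hM : M ⊨ locZFC) {n : ℕ} {φ : Fml n}
    (hφ : IsPi2 φ) (xs : Fin n → M)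
    (h : ∀ y : M, Nonempty (Elements y) → Elements y ⊨ ZFC → ∀ xs' : Fin n → Elements y,
      (∀ i, (xs' i).1 = xs i) → φ.Realize default xs') :
    φ.Realize default xs := by
  induction hφ with
  | sigma1 hφ =>
    obtain ⟨y, hne, hxs, hy, hZFC⟩ := exists_transitive_models_ZFC hM xs
    exact hφ.realize_of_elements hy (fun i => ⟨xs i, hxs i⟩)
      (h y hne (elements_models_ZFC hZFC) _ fun _ => rfl)
  | all _ ih =>
    refine BoundedFormula.realize_all.2 fun a => ih _ fun y hne hZFC xs' hxs' => ?_
    have := BoundedFormula.realize_all.1 (h y hne hZFC (fun i => xs' i.castSucc) fun i => by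
      simpa using hxs' i.castSucc) (xs' (Fin.last _))
    convert this
    exact (Fin.snoc_init_self xs').symm

end Absoluteness

end SetTh

theorem mainTheorem1 :
    (∀ n : ℕ, SetTh.LZFC.Proves (SetTh.tuplesInModels n)) ∧
    (∀ φ : SetTh.LSet.Sentence, SetTh.IsPi2 (n := 0) φ → SetTh.ZFC.Proves φ →
      SetTh.LZFC.Proves φ) := by
  open FirstOrder FirstOrder.Language SetTh in
  refine ⟨fun n => Theory.proves_of_forall_realize fun M _ _ hM => ?_, fun φ hφ h =>
    Theory.proves_of_forall_realize fun M _ _ hM => ?_⟩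
  all_goals
    have : M ⊨ BST := hM.mono Set.subset_union_left
    have h_loc : M ⊨ locZFC := hM.realize_of_mem _ (.inr rfl)
  · rw [tuplesInModels, Sentence.Realize, BoundedFormula.realize_alls]
    intro xs
    obtain ⟨y, -, hxs, hy, hZFC⟩ := exists_transitive_models_ZFC h_loc xs
    simp only [realize_fex, BoundedFormula.realize_inf, BoundedFormula.realize_iInf, realize_fmem,
      realize_isTransitive, realize_modelsZFC, Fin.snoc_last, Fin.snoc_castSucc]
    exact ⟨y, hxs, hy, hZFC⟩
  · refine (realize_sentence_iff default default).1
      (hφ.realize_of_forall_elements h_loc default fun y _ hZFC xs' _ => ?_)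
    exact (realize_sentence_iff default xs').2 (h.realize hZFC)
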